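/- Let $q$ be a power of a prime and let $W$ be a $5$-dimensional vector space over the finite field $\mathrm{GF}(q)$. Call two subspaces $U,V$ of $W$ adjacent if $$\dim U+\dim V-2\dim(U\cap V)=1$$ (equivalently, one is contained in the other and their dimensions differ by $1$). Then there exists a cyclic optimal $(5;q)$-subspace Gray code in $W$, that is, a sequence $C_0,C_1,\dots,C_{P-1}$ of pairwise distinct subspaces of $W$ of length $$P=\sum_{k=0}^{5}\binom{5}{k}_q ,\qquad \binom{n}{k}_q=\frac{[n]_q!}{[k]_q!\,[n-k]_q!},\quad [k]_q!=\prod_{i=1}^{k}\left(1+q+\dots+q^{i-1}\right),$$ such that $C_i$ and $C_{i+1}$ are adjacent for all $0\le i\le P-2$, and $C_{P-1}$ and $C_0$ are adjacent. -/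

import Mathlib

/-- The projective-space graph of a vector space `W` over `K`: its vertices are all subspaces of
`W`, and `U`, `V` are adjacent iff `dim U + dim V - 2 dim (U ∩ V) = 1`
(the difference is taken in `ℤ`). -/
def projectiveSpaceGraph (K W : Type*) [Field K] [AddCommGroup W] [Module K W] :
    SimpleGraph (Submodule K W) where
  Adj U V := (Module.finrank K U : ℤ) + Module.finrank K V
      - 2 * Module.finrank K (U ⊓ V : Submodule K W) = 1
  symm := ⟨fun U V h => by rw [inf_comm V U]; linarith⟩
  loopless := ⟨fun U h => by rw [inf_idem] at h; omega⟩

/-- The `q`-number `[k]_q = 1 + q + ⋯ + q ^ (k - 1)`. -/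
def qNumber (q k : ℕ) : ℕ := ∑ i ∈ Finset.range k, q ^ i

/-- `[k]_q! = [k]_q [k-1]_q ⋯ [1]_q`. -/
def qFactorial (q k : ℕ) : ℕ := ∏ i ∈ Finset.range k, qNumber q (i + 1)

/-- The Gaussian coefficient `[n]_q! / ([k]_q! [n-k]_q!)`, for `k ≤ n`, as a rational number. -/
def gaussianCoeff (q n k : ℕ) : ℚ :=
  (qFactorial q n : ℚ) / ((qFactorial q k : ℚ) * (qFactorial q (n - k) : ℚ))

/-- A subspace Gray code of size `P` in `W`: a sequence `C 0, …, C (P - 1)` of distinct subspaces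
of `W` in which consecutive ones are adjacent in the projective-space graph. -/
structure IsSubspaceGrayCode {K W : Type*} [Field K] [AddCommGroup W] [Module K W] {P : ℕ}
    (C : Fin P → Submodule K W) : Prop where
  distinct : Function.Injective C
  adj : ∀ (i : ℕ) (hi : i + 1 < P),
    (projectiveSpaceGraph K W).Adj (C ⟨i, Nat.lt_of_succ_lt hi⟩) (C ⟨i + 1, hi⟩)

/-- The sequence is cyclic: its first and last terms are adjacent. -/
def IsCyclicCode {K W : Type*} [Field K] [AddCommGroup W] [Module K W] {P : ℕ}
    (C : Fin P → Submodule K W) : Prop :=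
  ∃ hP : 0 < P, (projectiveSpaceGraph K W).Adj (C ⟨0, hP⟩) (C ⟨P - 1, Nat.sub_lt hP one_pos⟩)

/-- A code of size `P` in an `n`-dimensional space over the field with `q` elements is optimal
when `P` is the sum of the Gaussian coefficients `(n choose k)_q` over `0 ≤ k ≤ n`. -/
def IsOptimalSize (n q P : ℕ) : Prop :=
  (P : ℚ) = ∑ k ∈ Finset.range (n + 1), gaussianCoeff q n k

/-! Identify the space with a degree-5 field extension `F` of `K`, let `x` generate `Fˣ`, and let `N
= [5]_q` be the index of `Kˣ` in `Fˣ`. As 5 is prime, only scalars stabilise a proper nonzero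
subspace, so every orbit of such subspaces under `Fˣ` consists of the `N` translates by `x ^ i`, `i`
in `ZMod N`. There is one orbit of points, one of hyperplanes, and `q² + 1` orbits in each of
dimensions 2 and 3.

The spans of `1, x, …, x^(k-1)` for `k = 1, 2, 3, 4` represent four orbits `p, l, e, s`.
Multiplication by `x` maps each span into the next one, so besides the edges `p i – l i – e i – s i`
there are the zigzag edges `p (i+1) – l i` and `l (i+1) – e i`.

The other `q²` orbits in each of the dimensions 2 and 3 form a balanced bipartite graph under
incidence of representatives. Two different 3-spaces through a plane `L` that lie in one orbit are
determined by an ordered pair of points of `L`. This bounds the collisions and gives every degree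
more than `q² / 2`. A bipartite form of Dirac's theorem yields a Hamiltonian path, which lifts to
subspaces `r 0, …, r k` leading from `s 0` down to the point `p c`; translation gives such a path
from `s i` to `p (i + c)` for each `i`.

These strands, with a detour near `⊥` and `⊤`, form a spanning 2-regular graph. Its cycles are
merged by exchanging two opposite edges of a zigzag quadrilateral, which joins two distinct cycles
into one. The detour leaves the cycle through `⊥` and `⊤` cut off from all exchanges exactly when `c
= 1`. This is avoided because the last subspace of the path is a plane and has more than one point
to choose from. -/

namespace SimpleGraph

/-! ### Merging the cycles of a 2-factor by edge exchanges -/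

variable {V : Type*}

/-- The graph obtained from `H` by replacing the edges `ab`, `cd` by the edges `ac`, `bd`. -/
def exchange (H : SimpleGraph V) (a b c d : V) : SimpleGraph V :=
  H.deleteEdges {s(a, b), s(c, d)} ⊔ fromEdgeSet {s(a, c), s(b, d)}

theorem exchange_adj {H : SimpleGraph V} {a b c d v w : V} :
    (H.exchange a b c d).Adj v w ↔
      (H.Adj v w ∧ s(v, w) ≠ s(a, b) ∧ s(v, w) ≠ s(c, d)) ∨
        ((s(v, w) = s(a, c) ∨ s(v, w) = s(b, d)) ∧ v ≠ w) := by
  simp [exchange, not_or]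

/-- As `a` and `c` lie in different components, the four ends are distinct and `ac`, `bd` are new
edges, so each end loses one neighbour and gains one. -/
theorem exchange_ncard_neighborSet [Finite V] {H : SimpleGraph V} {a b c d : V}
    (hab : H.Adj a b) (hcd : H.Adj c d) (hac : ¬ H.Reachable a c) (v : V) :
    ((H.exchange a b c d).neighborSet v).ncard = (H.neighborSet v).ncard := by
  have rab := hab.reachable
  have rcd := hcd.reachable
  have key : ∀ {x y}, (x = a ∨ x = b) → (y = c ∨ y = d) → x ≠ y ∧ ¬ H.Adj x y ∧ ¬ H.Adj y x := by
    intro x y hx hy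
    have h : ¬ H.Reachable x y := by
      rcases hx with rfl | rfl <;> rcases hy with rfl | rfl
      · exact hac
      · exact fun h => hac (h.trans rcd.symm)
      · exact fun h => hac (rab.trans h)
      · exact fun h => hac ((rab.trans h).trans rcd.symm)
    exact ⟨fun e => h (e ▸ Reachable.refl _), fun e => h e.reachable,
      fun e => h e.symm.reachable⟩
  have k1 := key (Or.inl rfl) (Or.inl rfl)
  have k2 := key (Or.inl rfl) (Or.inr rfl)
  have k3 := key (Or.inr rfl) (Or.inl rfl)
  have k4 := key (Or.inr rfl) (Or.inr rfl)
  have nab := hab.ne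
  have ncd := hcd.ne
  have aux : ∀ {v x y : V}, (∀ w, (H.exchange a b c d).Adj v w ↔ w = x ∨ (H.Adj v w ∧ w ≠ y)) →
      ¬ H.Adj v x → H.Adj v y →
      ((H.exchange a b c d).neighborSet v).ncard = (H.neighborSet v).ncard := by
    intro v x y h1 h2 h3
    have : (H.exchange a b c d).neighborSet v = insert x (H.neighborSet v \ {y}) := by
      ext w; simp [h1]
    rw [this]
    exact Set.ncard_exchange h2 h3
  by_cases hva : v = a
  · subst hva
    refine aux (x := c) (y := b) (fun w => ?_) k1.2.1 hab
    rw [exchange_adj]; simp only [ne_eq, Sym2.eq_iff]; clear aux key; grind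
  by_cases hvb : v = b
  · subst hvb
    refine aux (x := d) (y := a) (fun w => ?_) k4.2.1 hab.symm
    rw [exchange_adj]; simp only [ne_eq, Sym2.eq_iff]; clear aux key; grind
  by_cases hvc : v = c
  · subst hvc
    refine aux (x := a) (y := d) (fun w => ?_) k1.2.2 hcd
    rw [exchange_adj]; simp only [ne_eq, Sym2.eq_iff]; clear aux key; grind
  by_cases hvd : v = d
  · subst hvd
    refine aux (x := b) (y := c) (fun w => ?_) k4.2.2 hcd.symm
    rw [exchange_adj]; simp only [ne_eq, Sym2.eq_iff]; clear aux key; grind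
  congr 1
  ext w
  simp only [mem_neighborSet]
  rw [exchange_adj]; simp only [ne_eq, Sym2.eq_iff]; clear aux key; grind

/-- Each deleted edge lies on a cycle, so its ends stay joined by the rest of that cycle. This rest
avoids the other deleted edge, which lies in another component. -/
theorem Reachable.exchange [Finite V] {H : SimpleGraph V} (hH : ∀ v, (H.neighborSet v).ncard = 2)
    {a b c d : V} (hab : H.Adj a b) (hcd : H.Adj c d) (hac : ¬ H.Reachable a c)
    {u v : V} (huv : H.Reachable u v) : (H.exchange a b c d).Reachable u v := by
  classical
  have hcyc : H.IsCycles := fun v _ => hH v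
  have aux : ∀ {a b c d : V}, H.Adj a b → ¬ H.Reachable a c →
      (H.deleteEdges {s(a, b), s(c, d)}).Reachable a b := by
    intro a b c d hab hac
    obtain ⟨w⟩ := hcyc.reachable_deleteEdges hab
    refine ⟨w.transfer _ fun e he => ?_⟩
    have he' := w.edges_subset_edgeSet he
    rw [edgeSet_deleteEdges] at he' ⊢
    refine ⟨he'.1, ?_⟩
    rintro (h | h)
    · exact he'.2 h
    · rw [Set.mem_singleton_iff] at h
      subst h
      have := w.fst_mem_support_of_mem_edges he
      exact hac (((w.takeUntil _ this).reachable).mono (deleteEdges_le _))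
  have h1 : (H.exchange a b c d).Reachable a b := (aux hab hac).mono le_sup_left
  have h2 : (H.exchange a b c d).Reachable c d := by
    refine Reachable.mono ?_ (aux (b := d) (c := a) (d := b) hcd (fun h => hac h.symm))
    rw [Set.pair_comm]
    exact le_sup_left
  obtain ⟨w⟩ := huv
  induction w with
  | nil => exact Reachable.refl _
  | @cons x y z hxy _ ih =>
    refine Reachable.trans ?_ ih
    by_cases e1 : s(x, y) = s(a, b)
    · rcases Sym2.eq_iff.1 e1 with ⟨rfl, rfl⟩ | ⟨rfl, rfl⟩
      exacts [h1, h1.symm]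
    by_cases e2 : s(x, y) = s(c, d)
    · rcases Sym2.eq_iff.1 e2 with ⟨rfl, rfl⟩ | ⟨rfl, rfl⟩
      exacts [h2, h2.symm]
    exact Adj.reachable (exchange_adj.2 (Or.inl ⟨hxy, e1, e2⟩))

/-- Successive exchanges of pairwise disjoint pairs of edges join the components that the pairs
of edges meet. -/
theorem exists_merge [Finite V] (G H : SimpleGraph V) (hHG : H ≤ G)
    (hH : ∀ v, (H.neighborSet v).ncard = 2) (n : ℕ) (a b c d : ℕ → V)
    (hab : ∀ i < n, H.Adj (a i) (b i)) (hcd : ∀ i < n, H.Adj (c i) (d i))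
    (hac : ∀ i < n, G.Adj (a i) (c i)) (hbd : ∀ i < n, G.Adj (b i) (d i))
    (hne : ∀ i < n, ∀ j < n, i < j →
      s(a j, b j) ≠ s(a i, b i) ∧ s(a j, b j) ≠ s(c i, d i) ∧
      s(c j, d j) ≠ s(a i, b i) ∧ s(c j, d j) ≠ s(c i, d i)) :
    ∃ H' ≤ G, (∀ v, (H'.neighborSet v).ncard = 2) ∧
      (∀ u v, H.Reachable u v → H'.Reachable u v) ∧ ∀ i < n, H'.Reachable (a i) (c i) := by
  -- The invariant also records that the edges of all pairs not yet treated are still present, which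
  -- `hne` guarantees.
  suffices ∀ m ≤ n, ∃ H' ≤ G, (∀ v, (H'.neighborSet v).ncard = 2) ∧
      (∀ u v, H.Reachable u v → H'.Reachable u v) ∧ (∀ i < m, H'.Reachable (a i) (c i)) ∧
      ∀ i < n, m ≤ i → H'.Adj (a i) (b i) ∧ H'.Adj (c i) (d i) by
    obtain ⟨H', h1, h2, h3, h4, -⟩ := this n le_rfl
    exact ⟨H', h1, h2, h3, h4⟩
  intro m
  induction m with
  | zero => exact fun _ => ⟨H, hHG, hH, fun _ _ h => h, by simp, fun i hi _ => ⟨hab i hi, hcd i hi⟩⟩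
  | succ m ih =>
    intro hm
    obtain ⟨H', h1, h2, h3, h4, h5⟩ := ih (by omega)
    -- Within a single cycle an exchange might split it, and nothing needs to be joined there, so it
    -- is skipped.
    by_cases hr : H'.Reachable (a m) (c m)
    · refine ⟨H', h1, h2, h3, fun i hi => ?_, fun i hi hi' => h5 i hi (by omega)⟩
      rcases Nat.lt_succ_iff_lt_or_eq.1 hi with hi | rfl
      exacts [h4 i hi, hr]
    obtain ⟨hab', hcd'⟩ := h5 m (by omega) le_rfl
    have hac' := hac m (by omega)
    have hR := fun u v => Reachable.exchange h2 hab' hcd' hr (u := u) (v := v)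
    refine ⟨H'.exchange (a m) (b m) (c m) (d m), ?_, fun v => ?_, fun u v h => hR _ _ (h3 u v h),
      fun i hi => ?_, fun i hi hi' => ?_⟩
    · refine sup_le ((deleteEdges_le _).trans h1) ?_
      intro x y hxy
      rw [fromEdgeSet_adj] at hxy
      rcases hxy.1 with h | h
      · rwa [← mem_edgeSet, h]
      · rw [Set.mem_singleton_iff] at h
        rw [← mem_edgeSet, h]
        exact hbd m (by omega)
    · rw [exchange_ncard_neighborSet hab' hcd' hr, h2]
    · rcases Nat.lt_succ_iff_lt_or_eq.1 hi with hi | rfl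
      · exact hR _ _ (h4 i hi)
      · exact Adj.reachable (exchange_adj.2 (Or.inr ⟨Or.inl rfl, hac'.ne⟩))
    · obtain ⟨n1, n2, n3, n4⟩ := hne m (by omega) i hi (by omega)
      obtain ⟨e1, e2⟩ := h5 i hi (by omega)
      exact ⟨exchange_adj.2 (Or.inl ⟨e1, n1, n2⟩), exchange_adj.2 (Or.inl ⟨e2, n3, n4⟩)⟩

/-- A connected spanning subgraph in which all degrees are two gives a cyclic enumeration. -/
theorem exists_cyclic_enumeration [Finite V] [Nonempty V] (G H : SimpleGraph V) (hHG : H ≤ G)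
    (hH : ∀ v, (H.neighborSet v).ncard = 2) (hconn : ∀ u v, H.Reachable u v) :
    ∃ (P : ℕ) (hP : 0 < P) (C : Fin P → V), Function.Bijective C ∧
      (∀ (i : ℕ) (hi : i + 1 < P), G.Adj (C ⟨i, Nat.lt_of_succ_lt hi⟩) (C ⟨i + 1, hi⟩)) ∧
      G.Adj (C ⟨0, hP⟩) (C ⟨P - 1, Nat.sub_lt hP one_pos⟩) := by
  have hcyc : H.IsCycles := fun v _ => hH v
  obtain ⟨v⟩ := ‹Nonempty V›
  obtain ⟨p, hp, hverts⟩ := hcyc.exists_cycle_toSubgraph_verts_eq_connectedComponentSupp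
    (v := v) (c := H.connectedComponentMk v) rfl
    (Set.nonempty_of_ncard_ne_zero (by rw [hH v]; norm_num))
  have hl := hp.three_le_length
  have hmem : ∀ w, w ∈ p.support := by
    intro w
    rw [← Walk.mem_verts_toSubgraph, hverts]
    exact ConnectedComponent.sound (hconn w v)
  -- The closed walk repeats its base vertex at index `p.length`; stopping before it lists each
  -- vertex once.
  refine ⟨p.length, by omega, fun i => p.getVert i, ⟨?_, ?_⟩, ?_, ?_⟩
  · intro i j hij
    have hi := i.2
    have hj := j.2
    exact Fin.ext (hp.getVert_injOn' (by simp; omega) (by simp; omega) hij)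
  · intro w
    obtain ⟨n, hn, hnl⟩ := Walk.mem_support_iff_exists_getVert.1 (hmem w)
    by_cases h : n < p.length
    · exact ⟨⟨n, h⟩, hn⟩
    · refine ⟨⟨0, by omega⟩, ?_⟩
      have : n = p.length := by omega
      subst this
      simpa using hn
  · intro i hi
    exact hHG (p.adj_getVert_succ (by omega))
  · have := p.adj_getVert_succ (i := p.length - 1) (by omega)
    rw [show p.length - 1 + 1 = p.length by omega, Walk.getVert_length] at this
    simpa using (hHG this).symm

end SimpleGraph

/-! ### The zigzag graph and its Hamiltonian cycle -/

/-- Vertices of the zigzag graph: two poles, four zigzag layers `p`, `l`, `e`, `s` of size `N` and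
`k + 1` further layers `r j` of size `N`. -/
inductive ZigzagVertex (N k : ℕ)
  | bot : ZigzagVertex N k
  | top : ZigzagVertex N k
  | p (i : ZMod N) : ZigzagVertex N k
  | l (i : ZMod N) : ZigzagVertex N k
  | e (i : ZMod N) : ZigzagVertex N k
  | s (i : ZMod N) : ZigzagVertex N k
  | r (j : Fin (k + 1)) (i : ZMod N) : ZigzagVertex N k

namespace ZigzagVertex

variable {N k : ℕ}

/-- One of the two neighbours in the initial 2-factor. -/
def up (c : ZMod N) : ZigzagVertex N k → ZigzagVertex N k
  | bot => p 1
  | top => s 0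
  | p i => if i = 1 ∨ i = 2 then bot else l i
  | l i => e i
  | e i => if i = 0 ∨ i = 1 then l (i + 1) else s i
  | s i => r 0 i
  | r j i => if h : j.1 < k then r ⟨j + 1, by omega⟩ i else p (i + c)

/-- The other neighbour in the initial 2-factor. -/
def dn (c : ZMod N) : ZigzagVertex N k → ZigzagVertex N k
  | bot => p 2
  | top => s 1
  | p i => r (Fin.last k) (i - c)
  | l i => if i = 1 ∨ i = 2 then e (i - 1) else p i
  | e i => l i
  | s i => if i = 0 ∨ i = 1 then top else e i
  | r j i => if j.1 = 0 then s i else r ⟨j - 1, by omega⟩ i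

theorem eq_up_or_eq_dn_symm (c : ZMod N) (u v : ZigzagVertex N k) (h : v = up c u ∨ v = dn c u) :
    u = up c v ∨ u = dn c v := by
  have h12 : (1 : ZMod N) + 1 = 2 := one_add_one_eq_two
  have h21 : (2 : ZMod N) - 1 = 1 := by rw [← h12]; ring
  rcases u with _ | _ | i | i | i | i | ⟨j, i⟩ <;> simp only [up, dn] at h <;>
    rcases h with rfl | rfl
  · simp [up]
  · simp [up]
  · simp [dn]
  · simp [dn]
  · split_ifs with h
    · rcases h with rfl | rfl <;> simp [up, dn]
    · simp [dn, h]
  · simp [up]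
  · simp [dn]
  · split_ifs with h
    · rcases h with rfl | rfl <;> simp [up, dn, h12, h21]
    · simp [up, h]
  · split_ifs with h
    · rcases h with rfl | rfl <;> simp [up, dn, h12, h21]
    · simp [dn, h]
  · simp [up]
  · simp [dn]
  · split_ifs with h
    · rcases h with rfl | rfl <;> simp [up, dn]
    · simp [up, h]
  · split_ifs with h
    · simp [dn]
    · have : j = Fin.last k := Fin.ext (by simp; omega)
      simp [dn, this]
  · split_ifs with h
    · have : j = 0 := Fin.ext h
      simp [up, this]
    · left
      have : j.1 - 1 < k := by omega
      simp only [up, this, dif_pos]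
      congr 1
      exact Fin.ext (by simp; omega)

theorem up_ne_dn (h10 : (1 : ZMod N) ≠ 0) (c : ZMod N) (u : ZigzagVertex N k) :
    up c u ≠ dn c u := by
  rcases u with _ | _ | i | i | i | i | ⟨j, i⟩ <;> simp only [up, dn]
  · intro h
    injection h with h
    exact h10 (by linear_combination -h)
  · intro h
    injection h with h
    exact h10 h.symm
  · split_ifs <;> simp
  · split_ifs with h
    · intro h'
      injection h' with h'
      exact h10 (by linear_combination h')
    · simp
  · split_ifs with h
    · intro h'
      injection h' with h'
      exact h10 (by linear_combination h')
    · simp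
  · split_ifs <;> simp
  · split_ifs with h1 h2
    · simp
    · intro h
      injection h with h
      rw [Fin.mk.injEq] at h
      omega
    · simp
    · simp

/-- The initial 2-factor of the zigzag graph. -/
def factor (c : ZMod N) : SimpleGraph (ZigzagVertex N k) where
  Adj u v := (v = up c u ∨ v = dn c u) ∧ u ≠ v
  symm := ⟨fun u v h => ⟨eq_up_or_eq_dn_symm c u v h.1, h.2.symm⟩⟩
  loopless := ⟨fun _ h => h.2 rfl⟩

theorem up_ne_self (c : ZMod N) (u : ZigzagVertex N k) : up c u ≠ u := by
  rcases u with _ | _ | i | i | i | i | ⟨j, i⟩ <;> simp only [up] <;> (try split_ifs) <;> simp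
  intro h
  simpa using congrArg Fin.val h

theorem dn_ne_self (c : ZMod N) (u : ZigzagVertex N k) : dn c u ≠ u := by
  rcases u with _ | _ | i | i | i | i | ⟨j, i⟩ <;> simp only [dn] <;> (try split_ifs) <;> simp
  intro h
  have := congrArg Fin.val h
  simp at this
  omega

theorem factor_ncard (h10 : (1 : ZMod N) ≠ 0) (c : ZMod N) (u : ZigzagVertex N k) :
    ((factor c).neighborSet u).ncard = 2 := by
  have : (factor c).neighborSet u = {up c u, dn c u} := by
    ext v
    simp only [factor, SimpleGraph.mem_neighborSet, Set.mem_insert_iff, Set.mem_singleton_iff]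
    constructor
    · exact fun h => h.1
    · rintro (rfl | rfl)
      · exact ⟨Or.inl rfl, (up_ne_self c u).symm⟩
      · exact ⟨Or.inr rfl, (dn_ne_self c u).symm⟩
  rw [this, Set.ncard_pair (up_ne_dn h10 c u)]

theorem factor_adj_up (c : ZMod N) (u : ZigzagVertex N k) :
    (factor c).Adj u (up c u) := ⟨Or.inl rfl, (up_ne_self c u).symm⟩

theorem factor_adj_dn (c : ZMod N) (u : ZigzagVertex N k) :
    (factor c).Adj u (dn c u) := ⟨Or.inr rfl, (dn_ne_self c u).symm⟩

/-- The adjacencies that a graph on the zigzag vertices is required to have. -/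
structure IsZigzag (c : ZMod N) (G : SimpleGraph (ZigzagVertex N k)) : Prop where
  bot_p : ∀ i, G.Adj bot (p i)
  top_s : ∀ i, G.Adj top (s i)
  p_l : ∀ i, G.Adj (p i) (l i)
  p_l' : ∀ i, G.Adj (p (i + 1)) (l i)
  l_e : ∀ i, G.Adj (l i) (e i)
  l_e' : ∀ i, G.Adj (l (i + 1)) (e i)
  e_s : ∀ i, G.Adj (e i) (s i)
  s_r : ∀ i, G.Adj (s i) (r 0 i)
  r_r : ∀ (j : ℕ) (hj : j < k) (i), G.Adj (r ⟨j, by omega⟩ i) (r ⟨j + 1, by omega⟩ i)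
  r_p : ∀ i, G.Adj (r (Fin.last k) i) (p (i + c))

theorem IsZigzag.factor_le {c : ZMod N} {G : SimpleGraph (ZigzagVertex N k)} (hG : IsZigzag c G) :
    factor c ≤ G := by
  have h12 : (1 : ZMod N) + 1 = 2 := one_add_one_eq_two
  have hup : ∀ u, G.Adj u (up c u) := by
    rintro (_ | _ | i | i | i | i | ⟨j, i⟩) <;> simp only [up]
    · exact hG.bot_p _
    · exact hG.top_s _
    · split_ifs
      exacts [(hG.bot_p _).symm, hG.p_l _]
    · exact hG.l_e _
    · split_ifs
      exacts [(hG.l_e' _).symm, hG.e_s _]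
    · exact hG.s_r _
    · split_ifs with h
      · exact hG.r_r _ h _
      · have : j = Fin.last k := Fin.ext (by simp; omega)
        exact this ▸ hG.r_p _
  intro u v h
  rcases h.1 with h' | h'
  · exact h' ▸ hup u
  have h1 := eq_up_or_eq_dn_symm c u v h.1
  rcases h1 with h1 | h1
  · rw [h1]
    exact (hup v).symm
  · rcases u with _ | _ | i | i | i | i | ⟨j, i⟩ <;> simp only [dn] at h'
    · exact h' ▸ hG.bot_p _
    · exact h' ▸ hG.top_s _
    · subst h'
      simpa using (hG.r_p (i - c)).symm
    · subst h'
      split_ifs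
      · simpa using hG.l_e' (i - 1)
      · exact (hG.p_l _).symm
    · exact h' ▸ (hG.l_e _).symm
    · subst h'
      split_ifs
      · exact (hG.top_s _).symm
      · exact (hG.e_s _).symm
    · subst h'
      split_ifs with h
      · have : j = 0 := Fin.ext h
        exact this ▸ (hG.s_r _).symm
      · have := (hG.r_r (j.1 - 1) (by omega) i).symm
        simp only [show j.1 - 1 + 1 = j.1 by omega] at this
        exact this

theorem exists_natCast_eq (hN : 4 ≤ N) (i : ZMod N) : ∃ m < N, (m : ZMod N) = i := by
  have : NeZero N := ⟨by omega⟩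
  exact ⟨i.val, i.val_lt, ZMod.natCast_zmod_val i⟩

theorem natCast_inj_of_lt {m n : ℕ} (hm : m < N) (hn : n < N) (h : (m : ZMod N) = n) : m = n := by
  have := congrArg ZMod.val h
  rwa [ZMod.val_cast_of_lt hm, ZMod.val_cast_of_lt hn] at this

/-- In the initial factor the pole `bot` takes `p 1, p 2`, the pole `top` takes `s 0, s 1`, and the
freed vertices are strung as `e 0 – l 1 – e 1 – l 2`. Exchanges then join all `l i`. For `c = 1` the
vertices `bot, p 1, s 0, top, s 1, p 2` would lie on a cycle that meets no `l i`. -/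
theorem IsZigzag.exists_hamiltonian [Finite (ZigzagVertex N k)] (hN : 4 ≤ N) {c : ZMod N}
    (hc : c ≠ 1) {G : SimpleGraph (ZigzagVertex N k)} (hG : IsZigzag c G) :
    ∃ H ≤ G, (∀ v, (H.neighborSet v).ncard = 2) ∧ ∀ u v, H.Reachable u v := by
  have hinj : ∀ {m n : ℕ}, m < N → n < N → m ≠ n → (m : ZMod N) ≠ n :=
    fun hm hn h h' => h (natCast_inj_of_lt hm hn h')
  have h10 : (1 : ZMod N) ≠ 0 := by simpa using hinj (m := 1) (n := 0) (by omega) (by omega)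
  have h20 : (2 : ZMod N) ≠ 0 := by simpa using hinj (m := 2) (n := 0) (by omega) (by omega)
  have h12 : (1 : ZMod N) + 1 = 2 := one_add_one_eq_two
  have h21 : (2 : ZMod N) ≠ 1 := fun h => h10 (by linear_combination h - h12)
  have hge : ∀ m : ℕ, 3 ≤ m → m < N → ¬ ((m : ZMod N) = 1 ∨ (m : ZMod N) = 2) := by
    rintro m h3 hm (h | h)
    · exact hinj hm (n := 1) (by omega) (by omega) (by simpa using h)
    · exact hinj hm (n := 2) (by omega) (by omega) (by simpa using h)
  have hge' : ∀ m : ℕ, 2 ≤ m → m < N → ¬ ((m : ZMod N) = 0 ∨ (m : ZMod N) = 1) := by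
    rintro m h3 hm (h | h)
    · exact hinj hm (n := 0) (by omega) (by omega) (by simpa using h)
    · exact hinj hm (n := 1) (by omega) (by omega) (by simpa using h)
  obtain ⟨H, hHG, hH2, hF, hac⟩ := SimpleGraph.exists_merge G (factor c) (hG.factor_le)
    -- With `m = i + 2`, the edges `p (m+1) – l (m+1)` and `l m – e m` are traded for `p (m+1) – l
    -- m` and `l (m+1) – e m`. The range `2 ≤ m ≤ N - 2` avoids the detour and the wrap-around.
    (factor_ncard h10 c) (N - 3) (fun i => p ((i + 3 : ℕ) : ZMod N))
    (fun i => l ((i + 3 : ℕ) : ZMod N)) (fun i => l ((i + 2 : ℕ) : ZMod N))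
    (fun i => e ((i + 2 : ℕ) : ZMod N))
    (by
      intro i hi
      have := factor_adj_up (k := k) c (p ((i + 3 : ℕ) : ZMod N))
      simpa only [up, hge (i + 3) (by omega) (by omega), if_false] using this)
    (fun i _ => factor_adj_up c (l _))
    (fun i _ => by
      have := hG.p_l' ((i + 2 : ℕ) : ZMod N)
      rwa [show ((i + 2 : ℕ) : ZMod N) + 1 = ((i + 3 : ℕ) : ZMod N) by push_cast; ring] at this)
    (fun i _ => by
      have := hG.l_e' ((i + 2 : ℕ) : ZMod N)
      rwa [show ((i + 2 : ℕ) : ZMod N) + 1 = ((i + 3 : ℕ) : ZMod N) by push_cast; ring] at this)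
    (by
      intro i hi j hj hij
      have e1 := hinj (m := i + 3) (n := j + 3) (by omega) (by omega) (by omega)
      have e2 := hinj (m := i + 2) (n := j + 2) (by omega) (by omega) (by omega)
      simp only [ne_eq, Sym2.eq_iff, p.injEq, l.injEq, e.injEq, reduceCtorEq, false_and, and_false,
        or_false, not_false_iff, true_and]
      exact ⟨fun h => e1 h.1.symm, fun h => e2 h.1.symm⟩)
  refine ⟨H, hHG, hH2, ?_⟩
  have Rup : ∀ u, H.Reachable u (up c u) := fun u => hF _ _ (factor_adj_up c u).reachable
  have Rdn : ∀ u, H.Reachable u (dn c u) := fun u => hF _ _ (factor_adj_dn c u).reachable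
  have Rle : ∀ i, H.Reachable (l i) (e i) := fun i => Rup (l i)
  have Rr : ∀ (j : Fin (k + 1)) i, H.Reachable (s i) (r j i) := by
    intro j i
    induction j using Fin.induction with
    | zero => exact Rup (s i)
    | succ j ih =>
      refine ih.trans ?_
      have := Rup (r j.castSucc i)
      simp only [up, Fin.val_castSucc, j.2, dif_pos] at this
      exact this
  have Rsp : ∀ i, H.Reachable (s i) (p (i + c)) := by
    intro i
    refine (Rr (Fin.last k) i).trans ?_
    have := Rup (r (Fin.last k) i)
    simpa only [up, Fin.val_last, lt_irrefl, dif_neg, not_false_iff] using this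
  have Rpl : ∀ i, ¬ (i = 1 ∨ i = 2) → H.Reachable (p i) (l i) := fun i hi => by
    have := Rup (p i)
    simpa only [up, hi, if_false] using this
  have Res : ∀ i, ¬ (i = 0 ∨ i = 1) → H.Reachable (e i) (s i) := fun i hi => by
    have := Rup (e i)
    simpa only [up, hi, if_false] using this
  have R12 : H.Reachable (p 1) (p 2) := (Rup bot).symm.trans (Rdn bot)
  have R01 : H.Reachable (s 0) (s 1) := (Rup top).symm.trans (Rdn top)
  have Re0 : H.Reachable (e 0) (l 1) := by
    have := Rup (e 0)
    simpa only [up, true_or, if_true, zero_add] using this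
  have Re1 : H.Reachable (e 1) (l 2) := by
    have := Rup (e 1)
    simpa only [up, or_true, if_true, h12] using this
  have Rp0 : H.Reachable (p 0) (l 0) := Rpl 0 (by
    rintro (h | h)
    exacts [h10 h.symm, h20 h.symm])
  -- the main component
  have X : ∀ m : ℕ, m < N → 2 ≤ m → H.Reachable (e 2) (l (m : ZMod N)) := by
    intro m hm h2
    induction m, h2 using Nat.le_induction with
    | base => simpa using (Rle 2).symm
    | succ m h2 ih =>
      refine (ih (by omega)).trans ?_
      have h1 := hac (m - 2) (by omega)
      simp only [show m - 2 + 3 = m + 1 by omega, show m - 2 + 2 = m by omega] at h1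
      exact h1.symm.trans (Rpl _ (hge (m + 1) (by omega) hm))
  have Xl : ∀ i, H.Reachable (e 2) (l i) := by
    intro i
    obtain ⟨m, hm, rfl⟩ := exists_natCast_eq hN i
    by_cases h2 : 2 ≤ m
    · exact X m hm h2
    -- The indices 0 and 1 are reached along the detour from `e 0` to `e 2`.
    have h1 : H.Reachable (e 2) (l 1) :=
      (Rle 2).symm.trans (Re1.symm.trans (Rle 1).symm)
    interval_cases m
    · simpa using h1.trans (Re0.symm.trans (Rle 0).symm)
    · simpa using h1
  have Xe : ∀ i, H.Reachable (e 2) (e i) := fun i => (Xl i).trans (Rle i)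
  have Xs : ∀ i, i ≠ 0 → i ≠ 1 → H.Reachable (e 2) (s i) :=
    fun i h0 h1 => (Xe i).trans (Res i (by tauto))
  have Xp : ∀ i, i ≠ 1 → i ≠ 2 → H.Reachable (e 2) (p i) :=
    fun i h0 h1 => (Xl i).trans (Rpl i (by tauto)).symm
  -- It remains to attach the pairs `p 1, p 2` and `s 0, s 1`, each joined through its pole. The
  -- strands reaching them end at `p c, p (1 + c), s (1 - c), s (2 - c)`, and for `c ≠ 1` some of
  -- these lie in the main component. The cases `c = 0` and `c = 2` are those in which a strand
  -- joins the two pairs directly.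
  have Xp12 : H.Reachable (e 2) (s 0) ∧ H.Reachable (e 2) (p 1) := by
    have b1 := Rsp (1 - c)
    have b2 := Rsp (2 - c)
    rw [sub_add_cancel] at b1 b2
    have a0 := Rsp 0
    have a1 := Rsp 1
    rw [zero_add] at a0
    have hs : H.Reachable (e 2) (s 0) ∨ (c ≠ 0 → c = 2) := by
      by_cases c0 : c = 0
      · exact Or.inr fun h => absurd c0 h
      by_cases c2 : c = 2
      · exact Or.inr fun _ => c2
      · refine Or.inl ((Xp c hc c2).trans a0.symm)
    by_cases c0 : c = 0
    · subst c0
      have h1 : H.Reachable (e 2) (p 2) := by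
        have := Xs 2 h20 h21
        exact this.trans (by simpa using b2)
      have h2 := h1.trans R12.symm
      refine ⟨h2.trans (?_ : H.Reachable _ _), h2⟩
      have : H.Reachable (s 1) (p 1) := by simpa using b1
      exact this.symm.trans R01.symm
    by_cases c2 : c = 2
    · subst c2
      have h3 : H.Reachable (e 2) (p (1 + 2)) := Xp _ (fun h => h20 (by linear_combination h))
        (fun h => h10 (by linear_combination h))
      have h0 := h3.trans (a1.symm.trans R01.symm)
      exact ⟨h0, h0.trans (a0.trans R12.symm)⟩
    · refine ⟨(Xp c hc c2).trans a0.symm, ?_⟩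
      have : H.Reachable (e 2) (s (2 - c)) := Xs _ (fun h => c2 (by linear_combination -h))
        (fun h => hc (by linear_combination h12 - h))
      exact this.trans (b2.trans R12.symm)
  have Xs' : ∀ i, H.Reachable (e 2) (s i) := by
    intro i
    by_cases h0 : i = 0
    · exact h0 ▸ Xp12.1
    by_cases h1 : i = 1
    · exact h1 ▸ Xp12.1.trans R01
    · exact Xs i h0 h1
  have Xp' : ∀ i, H.Reachable (e 2) (p i) := by
    intro i
    by_cases h1 : i = 1
    · exact h1 ▸ Xp12.2
    by_cases h2 : i = 2
    · exact h2 ▸ Xp12.2.trans R12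
    · exact Xp i h1 h2
  have Xall : ∀ u, H.Reachable (e 2) u := by
    rintro (_ | _ | i | i | i | i | ⟨j, i⟩)
    · exact (Xp' 1).trans (Rup bot).symm
    · exact (Xs' 0).trans (Rup top).symm
    · exact Xp' i
    · exact Xl i
    · exact Xe i
    · exact Xs' i
    · exact (Xs' i).trans (Rr j i)
  exact fun u v => (Xall u).symm.trans (Xall v)

end ZigzagVertex

/-! ### A Dirac-type theorem for balanced bipartite graphs -/

namespace SimpleGraph

variable {V : Type*} (G : SimpleGraph V)

open Classical in
/-- The number of non-adjacent pairs formed by an end of one list and the start of the next. -/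
noncomputable def junction : Option V → Option V → ℕ
  | some u, some v => if G.Adj u v then 0 else 1
  | _, _ => 0

/-- The number of consecutive non-adjacent pairs in a list. -/
noncomputable def gaps : List V → ℕ
  | [] => 0
  | [_] => 0
  | a :: b :: t => G.junction (some a) (some b) + gaps (b :: t)

theorem gaps_cons (a : V) (t : List V) : G.gaps (a :: t) = G.junction (some a) t.head? + G.gaps t := by
  cases t <;> simp [gaps, junction]

theorem gaps_append (x y : List V) :
    G.gaps (x ++ y) = G.gaps x + G.junction x.getLast? y.head? + G.gaps y := by
  induction x with
  | nil => simp [gaps, junction]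
  | cons a x ih =>
    rw [List.cons_append, gaps_cons, ih, gaps_cons]
    cases x with
    | nil => simp [gaps, junction]
    | cons b x => simp [List.getLast?_cons_cons]; omega

theorem junction_comm (x y : Option V) : G.junction x y = G.junction y x := by
  cases x <;> cases y <;> try rfl
  next u v => by_cases h : G.Adj u v <;> simp [junction, h, G.adj_comm v u]

theorem gaps_reverse (x : List V) : G.gaps x.reverse = G.gaps x := by
  induction x with
  | nil => rfl
  | cons a x ih =>
    rw [List.reverse_cons, gaps_append, ih, gaps_cons G a x, List.getLast?_reverse, junction_comm]
    simp only [gaps, List.head?_cons]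
    omega

theorem isChain_of_gaps_eq_zero {x : List V} (h : G.gaps x = 0) : x.IsChain G.Adj := by
  induction x with
  | nil => exact List.isChain_nil
  | cons a x ih =>
    cases x with
    | nil => exact List.isChain_singleton _
    | cons b x =>
      simp only [gaps, junction] at h
      rw [List.isChain_cons_cons]
      refine ⟨?_, ih (by omega)⟩
      by_contra hn
      simp [hn] at h

theorem exists_append_of_gaps_pos {x : List V} (h : 0 < G.gaps x) :
    ∃ p u v s, x = (p ++ [u]) ++ (v :: s) ∧ ¬ G.Adj u v := by
  induction x with
  | nil => simp [gaps] at h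
  | cons a x ih =>
    cases x with
    | nil => simp [gaps] at h
    | cons b x =>
      by_cases hab : G.Adj a b
      · simp only [gaps, junction, hab, if_true, zero_add] at h
        obtain ⟨p, u, v, s, e, hn⟩ := ih h
        exact ⟨a :: p, u, v, s, by rw [e]; simp, hn⟩
      · exact ⟨[], a, b, x, rfl, hab⟩

variable {G}

/-- The list `l` enumerates all vertices, with alternating colours and ends of distinct colours. -/
structure IsAlternatingList (col : V → Bool) (l : List V) : Prop where
  nodup : l.Nodup
  mem : ∀ v, v ∈ l
  chain : l.IsChain (fun u v => col u ≠ col v)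
  ends : ∀ u ∈ l.head?, ∀ v ∈ l.getLast?, col u ≠ col v

theorem IsAlternatingList.reverse {col : V → Bool} {l : List V} (h : IsAlternatingList col l) :
    IsAlternatingList col l.reverse where
  nodup := List.nodup_reverse.2 h.nodup
  mem v := List.mem_reverse.2 (h.mem v)
  chain := by
    rw [List.isChain_reverse]
    exact h.chain.imp fun _ _ h => h.symm
  ends u hu v hv := by
    rw [List.head?_reverse] at hu
    rw [List.getLast?_reverse] at hv
    exact (h.ends v hv u hu).symm

theorem IsAlternatingList.rotate {col : V → Bool} {p s : List V} (h : IsAlternatingList col (p ++ s))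
    (hp : p ≠ []) (hs : s ≠ []) : IsAlternatingList col (s ++ p) where
  nodup := by
    have := h.nodup
    rw [List.nodup_append_comm] at this
    exact this
  mem v := by
    have := h.mem v
    rw [List.mem_append] at this ⊢
    exact this.symm
  chain := by
    have := h.chain
    rw [List.isChain_append] at this ⊢
    refine ⟨this.2.1, this.1, fun u hu v hv => (h.ends v ?_ u ?_).symm⟩
    · rw [List.head?_append_of_ne_nil _ hp]; exact hv
    · rw [List.getLast?_append_of_ne_nil _ hs]; exact hu
  ends u hu v hv := by
    rw [List.head?_append_of_ne_nil _ hs] at hu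
    rw [List.getLast?_append_of_ne_nil _ hp] at hv
    have := h.chain
    rw [List.isChain_append] at this
    exact (this.2.2 v hv u hu).symm

theorem IsAlternatingList.reverse_append {col : V → Bool} {p s : List V}
    (h : IsAlternatingList col (p ++ s)) (hp : p ≠ []) (hs : s ≠ [])
    (h1 : ∀ u ∈ p.head?, ∀ v ∈ s.head?, col u ≠ col v)
    (h2 : ∀ u ∈ p.getLast?, ∀ v ∈ s.getLast?, col u ≠ col v) :
    IsAlternatingList col (p.reverse ++ s) where
  nodup := ((List.reverse_perm p).append_right s).nodup_iff.2 h.nodup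
  mem v := by simpa using h.mem v
  chain := by
    have := h.chain
    rw [List.isChain_append] at this ⊢
    refine ⟨?_, this.2.1, fun u hu v hv => h1 u ?_ v hv⟩
    · rw [List.isChain_reverse]
      exact this.1.imp fun _ _ h => h.symm
    · rwa [List.getLast?_reverse] at hu
  ends u hu v hv := by
    rw [List.head?_append_of_ne_nil _ (by simpa using hp), List.head?_reverse] at hu
    rw [List.getLast?_append_of_ne_nil _ hs] at hv
    exact h2 u hu v hv

theorem exists_isAlternating [Fintype V] [DecidableEq V] {col : V → Bool} {n : ℕ}
    (hcard : ∀ c, (Finset.univ.filter fun v => col v = c).card = n) :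
    ∃ l, IsAlternatingList col l := by
  have e : ∀ c, Nonempty (Fin n ≃ {v // col v = c}) := fun c =>
    ⟨(Fintype.equivFinOfCardEq (by rw [Fintype.card_subtype, hcard])).symm⟩
  obtain ⟨f⟩ := e false
  obtain ⟨g⟩ := e true
  let h : Fin n → List V := fun i => [(f i : V), (g i : V)]
  have hf : ∀ i, col (f i) = false := fun i => (f i).2
  have hg : ∀ i, col (g i) = true := fun i => (g i).2
  have key : ∀ L : List (Fin n), (L.flatMap h).IsChain (fun u v => col u ≠ col v) ∧
      (∀ u ∈ (L.flatMap h).head?, col u = false) ∧ ∀ u ∈ (L.flatMap h).getLast?, col u = true := by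
    intro L
    induction L with
    | nil => simp
    | cons i L ih =>
      obtain ⟨ih1, ih2, ih3⟩ := ih
      rw [List.flatMap_cons]
      refine ⟨?_, ?_, ?_⟩
      · rw [List.isChain_append]
        refine ⟨by simp [h, hf, hg], ih1, fun u hu v hv => ?_⟩
        have : u = g i := by simpa [h, eq_comm] using hu
        rw [ih2 v hv, this, hg]
        simp
      · intro u hu
        have : u = f i := by simpa [h, eq_comm] using hu
        rw [this, hf]
      · intro u hu
        by_cases hL : L.flatMap h = []
        · rw [hL] at hu
          have : u = g i := by simpa [h, eq_comm] using hu
          rw [this, hg]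
        · rw [List.getLast?_append_of_ne_nil _ hL] at hu
          exact ih3 u hu
  obtain ⟨k1, k2, k3⟩ := key (List.finRange n)
  refine ⟨(List.finRange n).flatMap h, ?_, ?_, k1, fun u hu v hv => by rw [k2 u hu, k3 v hv]; simp⟩
  · rw [List.nodup_flatMap]
    refine ⟨fun i _ => ?_, ?_⟩
    · have : (f i : V) ≠ g i := fun e => by
        have := hf i
        rw [e, hg] at this
        cases this
      simp [h, this]
    · refine (List.nodup_finRange n).imp fun {i j} hij => ?_
      have e1 : (f i : V) ≠ f j := fun e => hij (f.injective (Subtype.ext e))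
      have e2 : (g i : V) ≠ g j := fun e => hij (g.injective (Subtype.ext e))
      have e3 : ∀ i j, (f i : V) ≠ g j := fun i j e => by
        have := hf i
        rw [e, hg] at this
        cases this
      simp [h, Function.onFun, e1.symm, e2.symm, e3, (e3 _ _).symm]
  · intro v
    rw [List.mem_flatMap]
    cases hv : col v
    · obtain ⟨i, hi⟩ := f.surjective ⟨v, hv⟩
      exact ⟨i, List.mem_finRange i, by simp [h, hi]⟩
    · obtain ⟨i, hi⟩ := g.surjective ⟨v, hv⟩
      exact ⟨i, List.mem_finRange i, by simp [h, hi]⟩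

open Classical in
-- The crossing argument of Ore and Dirac: more than half of the possible cut positions have the
-- first vertex adjacent to the one just after the cut, and more than half have the last vertex
-- adjacent to the one just before it.
theorem exists_crossing [Fintype V] {col : V → Bool} (hcol : ∀ u v, G.Adj u v → col u ≠ col v)
    {n : ℕ} (hcard : ∀ c, (Finset.univ.filter fun v => col v = c).card = n)
    (hdeg : ∀ v, n < 2 * (Finset.univ.filter fun w => G.Adj v w).card)
    {l : List V} (hl : IsAlternatingList col l) (h0 : l ≠ []) :
    ∃ p s, l = p ++ s ∧ p ≠ [] ∧ s ≠ [] ∧ (∀ u ∈ p.head?, ∀ v ∈ s.head?, G.Adj u v) ∧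
      (∀ u ∈ p.getLast?, ∀ v ∈ s.getLast?, G.Adj u v) := by
  have hpos : 0 < l.length := List.length_pos_iff.2 h0
  set a := l.head h0 with ha
  set b := l.getLast h0 with hb
  have ha0 : a = l[0] := by rw [ha, List.head_eq_getElem]
  have hbl : b = l[l.length - 1] := by rw [hb, List.getLast_eq_getElem]
  have hcab : col a ≠ col b := hl.ends a (List.head_mem_head? h0) b (List.getLast_mem_getLast? h0)
  -- successors of neighbours of the last element
  let A := Finset.univ.filter fun i : Fin (l.length - 1) => G.Adj a (l[i.1 + 1]'(by omega))
  let B := Finset.univ.filter fun i : Fin (l.length - 1) => G.Adj b (l[i.1]'(by omega))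
  have hA : (Finset.univ.filter fun w => G.Adj a w).card ≤ A.card := by
    refine Finset.card_le_card_of_surjOn (fun i : Fin (l.length - 1) => l[i.1 + 1]'(by omega)) ?_
    intro w hw
    simp only [Finset.coe_filter, Finset.mem_univ, true_and, Set.mem_ofPred_eq] at hw
    obtain ⟨j, hj, rfl⟩ := List.mem_iff_getElem.1 (hl.mem w)
    have hj0 : j ≠ 0 := by
      rintro rfl
      rw [ha0] at hw
      exact G.loopless.irrefl _ hw
    refine ⟨⟨j - 1, by omega⟩, ?_, ?_⟩
    · simp only [A, Finset.coe_filter, Finset.mem_univ, true_and, Set.mem_ofPred_eq]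
      simpa only [show j - 1 + 1 = j by omega] using hw
    · simp only [show j - 1 + 1 = j by omega]
  have hB : (Finset.univ.filter fun w => G.Adj b w).card ≤ B.card := by
    refine Finset.card_le_card_of_surjOn (fun i : Fin (l.length - 1) => l[i.1]'(by omega)) ?_
    intro w hw
    simp only [Finset.coe_filter, Finset.mem_univ, true_and, Set.mem_ofPred_eq] at hw
    obtain ⟨j, hj, rfl⟩ := List.mem_iff_getElem.1 (hl.mem w)
    have hj0 : j ≠ l.length - 1 := by
      rintro rfl
      rw [hbl] at hw
      exact G.loopless.irrefl _ hw
    exact ⟨⟨j, by omega⟩, by simpa [B] using hw, rfl⟩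
  -- By alternation, the entry just before a cut counted in `A` or `B` always has the colour of `a`,
  -- so only `n` positions are available.
  have hAB : (A ∪ B).card ≤ n := by
    rw [← hcard (col a)]
    refine Finset.card_le_card_of_injOn (fun i : Fin (l.length - 1) => l[i.1]'(by omega)) ?_ ?_
    · intro i hi
      simp only [Finset.coe_filter, Finset.mem_univ, true_and, Set.mem_ofPred_eq]
      simp only [Finset.coe_union, Set.mem_union, Finset.mem_coe, A, B, Finset.mem_filter,
        Finset.mem_univ, true_and] at hi
      rcases hi with hi | hi
      · have h1 := hcol _ _ hi
        have h2 := List.isChain_iff_getElem.1 hl.chain i.1 (by omega)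
        revert h1 h2
        cases col a <;> cases col (l[i.1]'(by omega)) <;> cases col (l[i.1 + 1]'(by omega)) <;> simp
      · have h1 := hcol _ _ hi
        revert h1 hcab
        cases col a <;> cases col b <;> cases col (l[i.1]'(by omega)) <;> simp
    · intro i _ j _ hij
      exact Fin.ext ((List.Nodup.getElem_inj_iff hl.nodup).1 hij)
  have hne : (A ∩ B).Nonempty := by
    rw [← Finset.card_pos]
    have := Finset.card_union_add_card_inter A B
    have h1 := hdeg a
    have h2 := hdeg b
    omega
  obtain ⟨i, hi⟩ := hne
  simp only [A, B, Finset.mem_inter, Finset.mem_filter, Finset.mem_univ, true_and] at hi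
  have hil := i.2
  refine ⟨l.take (i + 1), l.drop (i + 1), (List.take_append_drop _ _).symm, ?_, ?_, ?_, ?_⟩
  · rw [← List.length_pos_iff, List.length_take]; omega
  · rw [← List.length_pos_iff, List.length_drop]; omega
  · intro u hu v hv
    rw [List.head?_take, if_neg (by omega), List.head?_eq_getElem?] at hu
    rw [List.head?_drop] at hv
    rw [Option.mem_def, List.getElem?_eq_some_iff] at hu hv
    obtain ⟨_, rfl⟩ := hu
    obtain ⟨_, rfl⟩ := hv
    exact ha0 ▸ hi.1
  · intro u hu v hv
    rw [List.getLast?_take, if_neg (by omega)] at hu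
    rw [List.getLast?_drop, if_neg (by omega), List.getLast?_eq_some_getLast h0] at hv
    simp only [Nat.add_sub_cancel, List.getElem?_eq_getElem (show i.1 < l.length by omega),
      Option.some_or, Option.mem_def, Option.some.injEq] at hu hv
    rw [← hu, ← hv]
    exact hi.2.symm

/-- A balanced bipartite graph with `n` vertices of each colour and all degrees greater than
`n / 2` has a Hamiltonian path, from a vertex of a given colour. -/
theorem exists_hamiltonian_path_of_bipartite [Fintype V] {col : V → Bool}
    (hcol : ∀ u v, G.Adj u v → col u ≠ col v)
    {n : ℕ} (hcard : ∀ c, (Finset.univ.filter fun v => col v = c).card = n)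
    (hdeg : ∀ v, n < 2 * {w | G.Adj v w}.ncard) (c : Bool) :
    ∃ l : List V, l.Nodup ∧ (∀ v, v ∈ l) ∧ l.IsChain G.Adj ∧ (∀ u ∈ l.head?, col u = c) ∧
      ∀ u ∈ l.getLast?, col u = !c := by
  classical
  have hdeg' : ∀ v, n < 2 * (Finset.univ.filter fun w => G.Adj v w).card := by
    intro v
    have := hdeg v
    rwa [← Finset.coe_filter_univ, Set.ncard_coe_finset] at this
  -- Start from any alternating ordering and lower the number of non-adjacent consecutive pairs one
  -- at a time.
  have main : ∀ m, ∀ l, IsAlternatingList col l → G.gaps l ≤ m →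
      ∃ l, IsAlternatingList col l ∧ G.gaps l = 0 := by
    intro m
    induction m with
    | zero => exact fun l hl hm => ⟨l, hl, by omega⟩
    | succ m ih =>
      intro l hl hm
      by_cases h0 : l = []
      · exact ih l hl (by simp [h0, gaps])
      obtain ⟨p, s, rfl, hp, hs, h1, h2⟩ := exists_crossing hcol hcard hdeg' hl h0
      have hl' := hl.reverse_append hp hs (fun u hu v hv => hcol _ _ (h1 u hu v hv))
        (fun u hu v hv => hcol _ _ (h2 u hu v hv))
      have j1 : G.junction p.head? s.head? = 0 := by
        rw [List.head?_eq_some_head hp, List.head?_eq_some_head hs]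
        simp [junction, h1 _ (List.head_mem_head? hp) _ (List.head_mem_head? hs)]
      have hgap : G.gaps (p.reverse ++ s) ≤ m + 1 := by
        rw [gaps_append] at hm ⊢
        rw [gaps_reverse, List.getLast?_reverse, j1]
        omega
      by_cases hz : G.gaps (p.reverse ++ s) = 0
      · exact ⟨_, hl', hz⟩
      obtain ⟨p', u, v, s', e, huv⟩ := G.exists_append_of_gaps_pos (Nat.pos_of_ne_zero hz)
      rw [e] at hl' hgap
      -- After the reversal the two ends of the list are adjacent, so it may be read cyclically.
      -- Cutting it at a remaining gap removes that gap, and the new junction costs nothing.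
      refine ih _ (hl'.rotate (by simp) (by simp)) ?_
      have e1 : (v :: s').getLast? = s.getLast? := by
        have := congrArg List.getLast? e
        rw [List.getLast?_append_of_ne_nil _ hs, List.getLast?_append_of_ne_nil _ (by simp)] at this
        exact this.symm
      have e2 : (p' ++ [u]).head? = p.getLast? := by
        have := congrArg List.head? e
        rw [List.head?_append_of_ne_nil _ (by simpa using hp),
          List.head?_append_of_ne_nil _ (by simp), List.head?_reverse] at this
        exact this.symm
      have j2 : G.junction s.getLast? p.getLast? = 0 := by
        rw [List.getLast?_eq_some_getLast hp, List.getLast?_eq_some_getLast hs]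
        simp [junction, (h2 _ (List.getLast_mem_getLast? hp) _ (List.getLast_mem_getLast? hs)).symm]
      rw [gaps_append] at hgap ⊢
      rw [e1, e2, j2]
      have j3 : G.junction (p' ++ [u]).getLast? (v :: s').head? = 1 := by
        simp [junction, huv]
      omega
  obtain ⟨l0, hl0⟩ := exists_isAlternating hcard
  obtain ⟨l, hl, hg⟩ := main _ l0 hl0 le_rfl
  have fin : ∀ l, IsAlternatingList col l → G.gaps l = 0 → (∀ u ∈ l.head?, col u = c) →
      ∃ l : List V, l.Nodup ∧ (∀ v, v ∈ l) ∧ l.IsChain G.Adj ∧ (∀ u ∈ l.head?, col u = c) ∧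
      ∀ u ∈ l.getLast?, col u = !c := by
    intro l hl hg hc
    refine ⟨l, hl.nodup, hl.mem, G.isChain_of_gaps_eq_zero hg, hc, fun u hu => ?_⟩
    have h0 : l ≠ [] := by
      rintro rfl
      simp at hu
    have := hl.ends _ (List.head_mem_head? h0) u hu
    rw [hc _ (List.head_mem_head? h0)] at this
    revert this
    cases c <;> cases col u <;> simp
  by_cases hc : ∀ u ∈ l.head?, col u = c
  · exact fin l hl hg hc
  · refine fin _ hl.reverse (by rw [gaps_reverse, hg]) fun v hv => ?_
    push Not at hc
    obtain ⟨u, hu, huc⟩ := hc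
    rw [List.head?_reverse] at hv
    have := hl.ends u hu v hv
    revert this huc
    cases c <;> cases col u <;> cases col v <;> simp

end SimpleGraph

/-! ### Adjacency of subspaces -/

open scoped Pointwise

theorem projectiveSpaceGraph_adj_map {K W W' : Type*} [Field K] [AddCommGroup W] [Module K W]
    [AddCommGroup W'] [Module K W'] (e : W ≃ₗ[K] W') {U V : Submodule K W}
    (h : (projectiveSpaceGraph K W).Adj U V) :
    (projectiveSpaceGraph K W').Adj (U.map e.toLinearMap) (V.map e.toLinearMap) := by
  have h' : (Module.finrank K U : ℤ) + Module.finrank K V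
      - 2 * Module.finrank K (U ⊓ V : Submodule K W) = 1 := h
  change (Module.finrank K (U.map e.toLinearMap) : ℤ) + Module.finrank K (V.map e.toLinearMap)
      - 2 * Module.finrank K (U.map e.toLinearMap ⊓ V.map e.toLinearMap : Submodule K W') = 1
  rw [← Submodule.map_inf _ e.injective, LinearEquiv.finrank_map_eq, LinearEquiv.finrank_map_eq,
    LinearEquiv.finrank_map_eq]
  exact h'

theorem projectiveSpaceGraph_adj_of_le {K W : Type*} [Field K] [AddCommGroup W] [Module K W]
    {U V : Submodule K W} (hUV : U ≤ V) (h : Module.finrank K V = Module.finrank K U + 1) :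
    (projectiveSpaceGraph K W).Adj U V := by
  change (Module.finrank K U : ℤ) + Module.finrank K V
      - 2 * Module.finrank K (U ⊓ V : Submodule K W) = 1
  rw [inf_eq_left.2 hUV, h]
  push_cast
  ring

/-! ### Counting subspaces and collisions -/

section Counting

variable {K W : Type*} [Field K] [AddCommGroup W] [Module K W]

theorem natCard_finrank_eq_one [Finite K] {d : ℕ} (h : Module.finrank K W = d) :
    Nat.card {H : Submodule K W // Module.finrank K H = 1} = qNumber (Nat.card K) d := by
  rw [← Nat.card_congr (Projectivization.equivSubmodule K W),
    Projectivization.card_of_finrank K W h, qNumber]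

theorem ncard_finrank_eq_one_le [Finite K] {d : ℕ} {U : Submodule K W} (h : Module.finrank K U = d) :
    {H : Submodule K W | Module.finrank K H = 1 ∧ H ≤ U}.ncard = qNumber (Nat.card K) d := by
  rw [← natCard_finrank_eq_one h, ← Nat.card_coe_set_eq]
  refine Nat.card_congr (Equiv.ofBijective (fun H => ⟨H.1.map U.subtype,
    (Submodule.finrank_map_subtype_eq U H.1).trans H.2, Submodule.map_subtype_le U H.1⟩)
    ⟨?_, ?_⟩).symm
  · intro H H' hH
    exact Subtype.ext (Submodule.map_injective_of_injective U.injective_subtype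
      (congrArg Subtype.val hH))
  · rintro ⟨H, h1, h2⟩
    have e : (H.comap U.subtype).map U.subtype = H := by
      rw [Submodule.map_comap_subtype, inf_eq_right.2 h2]
    refine ⟨⟨H.comap U.subtype, ?_⟩, Subtype.ext e⟩
    rw [← Submodule.finrank_map_subtype_eq, e, h1]

theorem finrank_comap_mkQ [FiniteDimensional K W] (U : Submodule K W) (H : Submodule K (W ⧸ U)) :
    Module.finrank K (H.comap U.mkQ) = Module.finrank K H + Module.finrank K U := by
  have h1 := Submodule.finrank_quotient_add_finrank (H.comap U.mkQ)
  have h2 := Submodule.finrank_quotient_add_finrank H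
  have h3 := Submodule.finrank_quotient_add_finrank U
  have e : Module.finrank K (W ⧸ H.comap U.mkQ) = Module.finrank K ((W ⧸ U) ⧸ H) := by
    have := (H.mkQ ∘ₗ U.mkQ).quotKerEquivOfSurjective
      ((Submodule.mkQ_surjective H).comp (Submodule.mkQ_surjective U))
    rw [LinearMap.ker_comp, Submodule.ker_mkQ] at this
    exact this.finrank_eq
  omega

theorem ncard_finrank_eq_add_one_ge [Finite K] [FiniteDimensional K W] {d m : ℕ} {U : Submodule K W} (hU : Module.finrank K U = d)
    (hW : Module.finrank K W = m + d) :
    {V : Submodule K W | Module.finrank K V = d + 1 ∧ U ≤ V}.ncard = qNumber (Nat.card K) m := by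
  have hQ : Module.finrank K (W ⧸ U) = m := by
    have := Submodule.finrank_quotient_add_finrank U
    omega
  rw [← natCard_finrank_eq_one hQ, ← Nat.card_coe_set_eq]
  refine Nat.card_congr (Equiv.ofBijective (fun H => ⟨H.1.comap U.mkQ,
    by rw [finrank_comap_mkQ, H.2, hU, add_comm], Submodule.le_comap_mkQ U H.1⟩) ⟨?_, ?_⟩).symm
  · intro H H' hH
    exact Subtype.ext (Submodule.comap_injective_of_surjective (Submodule.mkQ_surjective U)
      (congrArg Subtype.val hH))
  · rintro ⟨V, h1, h2⟩
    have e : (V.map U.mkQ).comap U.mkQ = V := by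
      rw [Submodule.comap_map_mkQ, sup_eq_right.2 h2]
    refine ⟨⟨V.map U.mkQ, ?_⟩, Subtype.ext e⟩
    have := finrank_comap_mkQ U (V.map U.mkQ)
    rw [e] at this
    omega

/-- The number of planes through the origin in a space of dimension `m + 1`. -/
theorem ncard_finrank_eq_two [Finite K] [FiniteDimensional K W] {m : ℕ} (hW : Module.finrank K W = m + 1) :
    {L : Submodule K W | Module.finrank K L = 2}.ncard * qNumber (Nat.card K) 2 =
      qNumber (Nat.card K) (m + 1) * qNumber (Nat.card K) m := by
  classical
  have : Finite W := Module.finite_of_finite K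
  have := Fintype.ofFinite (Submodule K W)
  -- Double count the incident pairs of a 1-dimensional and a 2-dimensional subspace.
  have h := Finset.card_mul_eq_card_mul (fun A B : Submodule K W => A ≤ B)
    (s := Finset.univ.filter fun A : Submodule K W => Module.finrank K A = 1)
    (t := Finset.univ.filter fun A : Submodule K W => Module.finrank K A = 2)
    (m := qNumber (Nat.card K) m) (n := qNumber (Nat.card K) 2) ?_ ?_
  · have e : (Finset.univ.filter fun A : Submodule K W => Module.finrank K A = 1).card =
        qNumber (Nat.card K) (m + 1) := by
      rw [← natCard_finrank_eq_one hW, Nat.card_eq_fintype_card, Fintype.card_subtype]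
    rw [e] at h
    rw [h, Set.ncard_eq_toFinset_card', Set.toFinset_ofPred]
  · intro A hA
    rw [Finset.mem_filter] at hA
    rw [← ncard_finrank_eq_add_one_ge hA.2 hW, ← Set.ncard_coe_finset]
    congr 1
    ext B
    simp [Finset.bipartiteAbove]
  · intro B hB
    rw [Finset.mem_filter] at hB
    rw [← ncard_finrank_eq_one_le hB.2, ← Set.ncard_coe_finset]
    congr 1
    ext A
    simp [Finset.bipartiteBelow]

end Counting

/-- Fix one representative in each fibre. Every other element of `S` forms two ordered collision
pairs with its representative, and all these pairs are distinct. -/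
theorem Finset.two_mul_card_le_of_pairs {α β : Type*} [DecidableEq α] [DecidableEq β] (f : α → β)
    (S : Finset α) :
    2 * S.card ≤ 2 * (S.image f).card + (S.offDiag.filter fun p => f p.1 = f p.2).card := by
  rcases isEmpty_or_nonempty α with _ | _
  · simp [Subsingleton.elim S ∅]
  have hσ : ∀ b ∈ S.image f, ∃ a ∈ S, f a = b := fun b hb => by simpa using hb
  choose! σ hσS hσf using hσ
  set R := (S.image f).image σ with hR
  have hRS : R ⊆ S := by
    intro a ha
    obtain ⟨b, hb, rfl⟩ := Finset.mem_image.1 ha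
    exact hσS b hb
  have hRcard : R.card ≤ (S.image f).card := Finset.card_image_le
  have hmem : ∀ a ∈ S, σ (f a) ∈ R := fun a ha =>
    Finset.mem_image_of_mem _ (Finset.mem_image_of_mem _ ha)
  have hf : ∀ a ∈ S, f (σ (f a)) = f a := fun a ha => hσf _ (Finset.mem_image_of_mem _ ha)
  let P1 := (S \ R).image fun a => (a, σ (f a))
  let P2 := (S \ R).image fun a => (σ (f a), a)
  have h1 : P1.card = (S \ R).card :=
    Finset.card_image_of_injective _ fun a b h => (Prod.mk.inj h).1
  have h2 : P2.card = (S \ R).card :=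
    Finset.card_image_of_injective _ fun a b h => (Prod.mk.inj h).2
  have hdisj : Disjoint P1 P2 := by
    rw [Finset.disjoint_left]
    rintro p hp1 hp2
    obtain ⟨a, ha, rfl⟩ := Finset.mem_image.1 hp1
    obtain ⟨b, hb, hab⟩ := Finset.mem_image.1 hp2
    rw [Finset.mem_sdiff] at ha hb
    have := (Prod.mk.inj hab).1
    exact ha.2 (this ▸ hmem b hb.1)
  have hsub : P1 ∪ P2 ⊆ S.offDiag.filter fun p => f p.1 = f p.2 := by
    intro p hp
    rw [Finset.mem_union] at hp
    rw [Finset.mem_filter, Finset.mem_offDiag]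
    rcases hp with hp | hp
    · obtain ⟨a, ha, rfl⟩ := Finset.mem_image.1 hp
      rw [Finset.mem_sdiff] at ha
      exact ⟨⟨ha.1, hRS (hmem a ha.1), fun e : a = σ (f a) => ha.2 (e.symm ▸ hmem a ha.1)⟩, (hf a ha.1).symm⟩
    · obtain ⟨a, ha, rfl⟩ := Finset.mem_image.1 hp
      rw [Finset.mem_sdiff] at ha
      exact ⟨⟨hRS (hmem a ha.1), ha.1, fun e : σ (f a) = a => ha.2 (e ▸ hmem a ha.1)⟩, hf a ha.1⟩
  have h3 := Finset.card_le_card hsub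
  rw [Finset.card_union_of_disjoint hdisj, h1, h2] at h3
  have h4 := Finset.card_sdiff_add_card_eq_card hRS
  omega

/-! ### The action of the multiplicative group on subspaces -/

section Action

variable {K F : Type*} [Field K] [Field F] [Algebra K F]

theorem units_smul_eq_map (g : Fˣ) (U : Submodule K F) :
    g • U = U.map (DistribMulAction.toLinearEquiv K F g).toLinearMap := rfl

theorem mul_mem_units_smul {g : Fˣ} {U : Submodule K F} {a : F} (ha : a ∈ U) :
    (g : F) * a ∈ g • U := ⟨a, ha, rfl⟩

theorem finrank_units_smul (g : Fˣ) (U : Submodule K F) :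
    Module.finrank K (g • U : Submodule K F) = Module.finrank K U := by
  rw [units_smul_eq_map, LinearEquiv.finrank_map_eq]

theorem units_smul_le_smul {U V : Submodule K F} (g : Fˣ) (h : U ≤ V) : g • U ≤ g • V :=
  Submodule.map_mono h

theorem projectiveSpaceGraph_adj_smul (g : Fˣ) {U V : Submodule K F}
    (h : (projectiveSpaceGraph K F).Adj U V) : (projectiveSpaceGraph K F).Adj (g • U) (g • V) :=
  projectiveSpaceGraph_adj_map (DistribMulAction.toLinearEquiv K F g) h

variable (K F) in
/-- The units of `F` that come from `K`. -/
def scalarUnits : Subgroup Fˣ := (Units.map (algebraMap K F).toMonoidHom).range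

theorem mem_scalarUnits {g : Fˣ} : g ∈ scalarUnits K F ↔ ∃ k : K, algebraMap K F k = g := by
  constructor
  · rintro ⟨k, rfl⟩
    exact ⟨k, rfl⟩
  · rintro ⟨k, hk⟩
    have hk0 : k ≠ 0 := by
      rintro rfl
      exact g.ne_zero (by rw [← hk, map_zero])
    exact ⟨Units.mk0 k hk0, Units.ext hk⟩

theorem units_smul_of_mem_scalarUnits {g : Fˣ} (hg : g ∈ scalarUnits K F) (U : Submodule K F) :
    g • U = U := by
  have key : ∀ g : Fˣ, g ∈ scalarUnits K F → g • U ≤ U := by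
    intro g hg
    obtain ⟨k, hk⟩ := mem_scalarUnits.1 hg
    rintro _ ⟨b, hb, rfl⟩
    change (g : F) * b ∈ U
    rw [← hk, ← Algebra.smul_def]
    exact U.smul_mem k hb
  refine le_antisymm (key g hg) ?_
  have := units_smul_le_smul g (key _ (inv_mem hg))
  rwa [smul_inv_smul] at this

/-- In prime degree, only scalars stabilise a proper nonzero subspace. -/
theorem mem_scalarUnits_of_smul_eq (hF : (Module.finrank K F).Prime) {g : Fˣ} {U : Submodule K F}
    (hbot : U ≠ ⊥) (htop : U ≠ ⊤) (h : g • U = U) : g ∈ scalarUnits K F := by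
  -- The multipliers of `U` form an intermediate ring, which in prime degree is `K` or `F`; the
  -- latter would force `U = ⊤`.
  let A : Subalgebra K F :=
    { carrier := {a | ∀ u ∈ U, a * u ∈ U}
      mul_mem' := fun {a b} ha hb u hu => by rw [mul_assoc]; exact ha _ (hb u hu)
      add_mem' := fun {a b} ha hb u hu => by rw [add_mul]; exact U.add_mem (ha u hu) (hb u hu)
      algebraMap_mem' := fun k u hu => by rw [← Algebra.smul_def]; exact U.smul_mem k hu }
  have hgA : (g : F) ∈ A := fun u hu => h ▸ mul_mem_units_smul hu
  have := Subalgebra.isSimpleOrder_of_finrank_prime K F hF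
  rcases eq_bot_or_eq_top A with hA | hA
  · rw [hA, Algebra.mem_bot] at hgA
    exact mem_scalarUnits.2 hgA
  · exfalso
    obtain ⟨u, hu, hu0⟩ := (Submodule.ne_bot_iff U).1 hbot
    refine htop (eq_top_iff.2 fun a _ => ?_)
    have : a * u⁻¹ ∈ A := hA ▸ Algebra.mem_top
    have := this u hu
    rwa [mul_assoc, inv_mul_cancel₀ hu0, mul_one] at this

variable {x : Fˣ} {N : ℕ}

/-- The translation of subspaces by a power of `x`, with exponent modulo `N`. -/
noncomputable def singerShift (x : Fˣ) (i : ZMod N) (U : Submodule K F) : Submodule K F :=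
  x ^ i.val • U

theorem finrank_singerShift (i : ZMod N) (U : Submodule K F) :
    Module.finrank K (singerShift x i U) = Module.finrank K U := finrank_units_smul _ _

theorem singerShift_adj (i : ZMod N) {U V : Submodule K F}
    (h : (projectiveSpaceGraph K F).Adj U V) :
    (projectiveSpaceGraph K F).Adj (singerShift x i U) (singerShift x i V) :=
  projectiveSpaceGraph_adj_smul _ h

variable (K F) in
theorem index_scalarUnits [Finite K] [FiniteDimensional K F] {d : ℕ} (hF : Module.finrank K F = d) :
    (scalarUnits K F).index = qNumber (Nat.card K) d := by
  have : Finite F := Module.finite_of_finite K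
  have h1 := (scalarUnits K F).card_mul_index
  have h2 : Nat.card (scalarUnits K F) = Nat.card K - 1 := by
    rw [scalarUnits, ← Nat.card_units]
    exact (Nat.card_congr (MonoidHom.ofInjective
      (Units.map_injective (algebraMap K F).injective)).toEquiv).symm
  have hq : 1 < Nat.card K := Finite.one_lt_card
  rw [h2, Nat.card_units, Module.natCard_eq_pow_finrank (K := K) (V := F), hF] at h1
  have h3 := Nat.geomSum_eq hq d
  rw [qNumber, h3, ← h1, Nat.mul_div_cancel_left _ (by omega)]

/-- The class of `x` generates the quotient of `Fˣ` by the scalars and so has order `N`. This makes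
exponents modulo `N` meaningful on subspaces. -/
theorem pow_eq_pow_mod_scalarUnits (hx : ∀ g : Fˣ, g ∈ Subgroup.zpowers x)
    (hN : (scalarUnits K F).index = N) {i j : ℕ} :
    (x ^ i)⁻¹ * x ^ j ∈ scalarUnits K F ↔ i % N = j % N := by
  have ho : orderOf (QuotientGroup.mk x : Fˣ ⧸ scalarUnits K F) = N := by
    rw [← hN, Subgroup.index]
    refine orderOf_eq_card_of_forall_mem_zpowers fun g => ?_
    obtain ⟨g, rfl⟩ := QuotientGroup.mk_surjective g
    obtain ⟨n, rfl⟩ := hx g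
    exact ⟨n, rfl⟩
  rw [← QuotientGroup.eq, QuotientGroup.mk_pow, QuotientGroup.mk_pow, ← ho]
  exact pow_inj_mod (x := (QuotientGroup.mk x : Fˣ ⧸ scalarUnits K F))

theorem pow_smul_eq_of_mod_eq (hx : ∀ g : Fˣ, g ∈ Subgroup.zpowers x)
    (hN : (scalarUnits K F).index = N) {i j : ℕ} (h : i % N = j % N) (U : Submodule K F) :
    x ^ i • U = x ^ j • U := by
  have := units_smul_of_mem_scalarUnits ((pow_eq_pow_mod_scalarUnits hx hN).2 h) U
  rw [mul_smul, inv_smul_eq_iff] at this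
  exact this.symm

theorem singerShift_natCast [NeZero N] (hx : ∀ g : Fˣ, g ∈ Subgroup.zpowers x)
    (hN : (scalarUnits K F).index = N) (m : ℕ) (U : Submodule K F) :
    singerShift x (m : ZMod N) U = x ^ m • U :=
  pow_smul_eq_of_mod_eq hx hN (by rw [ZMod.val_natCast, Nat.mod_mod]) U

theorem singerShift_add [NeZero N] (hx : ∀ g : Fˣ, g ∈ Subgroup.zpowers x)
    (hN : (scalarUnits K F).index = N) (i j : ZMod N) (U : Submodule K F) :
    singerShift x (i + j) U = singerShift x i (singerShift x j U) := by
  rw [singerShift, singerShift, singerShift, ← mul_smul, ← pow_add]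
  exact pow_smul_eq_of_mod_eq hx hN (by rw [ZMod.val_add, Nat.mod_mod]) U

theorem singerShift_injective [NeZero N] (hF : (Module.finrank K F).Prime)
    (hx : ∀ g : Fˣ, g ∈ Subgroup.zpowers x) (hN : (scalarUnits K F).index = N)
    {U : Submodule K F} (hbot : U ≠ ⊥) (htop : U ≠ ⊤) {i j : ZMod N}
    (h : singerShift x i U = singerShift x j U) : i = j := by
  have : ((x ^ i.val)⁻¹ * x ^ j.val) • U = U := by
    rw [mul_smul, inv_smul_eq_iff]
    exact h.symm
  have := (pow_eq_pow_mod_scalarUnits hx hN).1 (mem_scalarUnits_of_smul_eq hF hbot htop this)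
  rw [Nat.mod_eq_of_lt i.val_lt, Nat.mod_eq_of_lt j.val_lt] at this
  exact ZMod.val_injective N this

theorem exists_singerShift_eq [Finite K] [FiniteDimensional K F] [NeZero N] (hx : ∀ g : Fˣ, g ∈ Subgroup.zpowers x)
    (hN : (scalarUnits K F).index = N) (g : Fˣ) (U : Submodule K F) :
    ∃ i : ZMod N, singerShift x i U = g • U := by
  have : Finite F := Module.finite_of_finite K
  obtain ⟨m, rfl⟩ := mem_powers_iff_mem_zpowers.2 (hx g)
  exact ⟨m, singerShift_natCast hx hN m U⟩

end Action

/-! ### The standard flag spanned by powers -/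

section PowerSpan

variable {K F : Type*} [Field K] [Field F] [Algebra K F]

variable (K) in
/-- The span of the first `k` powers of `x`. -/
noncomputable def powerSpan (x : F) (k : ℕ) : Submodule K F :=
  Submodule.span K (Set.range fun i : Fin k => x ^ i.1)

theorem powerSpan_le_succ (x : F) (k : ℕ) : powerSpan K x k ≤ powerSpan K x (k + 1) := by
  refine Submodule.span_mono ?_
  rintro _ ⟨i, rfl⟩
  exact ⟨i.castSucc, rfl⟩

theorem smul_powerSpan_le_succ (x : Fˣ) (k : ℕ) :
    x • powerSpan K (x : F) k ≤ powerSpan K (x : F) (k + 1) := by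
  rw [units_smul_eq_map, powerSpan, Submodule.map_span, Submodule.span_le]
  rintro _ ⟨_, ⟨i, rfl⟩, rfl⟩
  refine Submodule.subset_span ⟨i.succ, ?_⟩
  change (x : F) ^ (i.1 + 1) = x * (x : F) ^ i.1
  rw [pow_succ']

/-- In prime degree a non-scalar `x` generates `F`, so its minimal polynomial has full degree and
the lower powers are independent. -/
theorem finrank_powerSpan [FiniteDimensional K F] (hF : (Module.finrank K F).Prime) {x : F}
    (hx : x ∉ Set.range (algebraMap K F)) {k : ℕ} (hk : k ≤ Module.finrank K F) :
    Module.finrank K (powerSpan K x k) = k := by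
  have := Subalgebra.isSimpleOrder_of_finrank_prime K F hF
  have htop : Algebra.adjoin K {x} = ⊤ := by
    refine (eq_bot_or_eq_top _).resolve_left fun h => hx ?_
    have : x ∈ Algebra.adjoin K {x} := Algebra.self_mem_adjoin_singleton K x
    rwa [h, Algebra.mem_bot] at this
  have hint : IsIntegral K x := Algebra.IsIntegral.isIntegral x
  have hdeg : (minpoly K x).natDegree = Module.finrank K F := by
    have h1 := (Algebra.adjoin.powerBasis hint).finrank
    rw [Algebra.adjoin.powerBasis_dim, htop, subalgebra_top_finrank_eq_submodule_top_finrank,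
      finrank_top] at h1
    exact h1.symm
  have hli := linearIndependent_pow (K := K) x
  have : LinearIndependent K fun i : Fin k => x ^ i.1 :=
    hli.comp (Fin.castLE (hk.trans hdeg.ge)) (Fin.castLE_injective _)
  rw [powerSpan, finrank_span_eq_card this, Fintype.card_fin]

end PowerSpan

/-! ### Duality by the trace form -/

section Dual

variable {K F : Type*} [Field K] [Field F] [Algebra K F]

/-- The orthogonal complement of a subspace under the trace form. -/
noncomputable def tracePerp (U : Submodule K F) : Submodule K F :=
  (Algebra.traceForm K F).orthogonal U

theorem mem_tracePerp {U : Submodule K F} {a : F} :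
    a ∈ tracePerp U ↔ ∀ u ∈ U, Algebra.trace K F (u * a) = 0 := Iff.rfl

theorem tracePerp_anti {U V : Submodule K F} (h : U ≤ V) : tracePerp V ≤ tracePerp U :=
  fun _ ha u hu => ha u (h hu)

/-- Multiplication by `g` is self-adjoint for the trace form. Hence duality permutes the orbits. -/
theorem tracePerp_smul (g : Fˣ) (U : Submodule K F) : tracePerp (g • U) = g⁻¹ • tracePerp U := by
  ext a
  have : a ∈ g⁻¹ • tracePerp U ↔ (g : F) * a ∈ tracePerp U := by
    constructor
    · rintro ⟨b, hb, rfl⟩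
      change (g : F) * (((g⁻¹ : Fˣ) : F) * b) ∈ _
      rwa [Units.mul_inv_cancel_left]
    · intro h
      exact ⟨g * a, h, Units.inv_mul_cancel_left g a⟩
  rw [this, mem_tracePerp, mem_tracePerp]
  constructor
  · intro h u hu
    rw [← mul_assoc, mul_comm u]
    exact h _ (mul_mem_units_smul hu)
  · rintro h _ ⟨u, hu, rfl⟩
    have := h u hu
    rw [← mul_assoc, mul_comm u] at this
    exact this

variable [Finite K] [FiniteDimensional K F]

theorem finrank_tracePerp (U : Submodule K F) :
    Module.finrank K (tracePerp U) = Module.finrank K F - Module.finrank K U :=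
  LinearMap.BilinForm.finrank_orthogonal (traceForm_nondegenerate K F) U

theorem tracePerp_tracePerp (U : Submodule K F) : tracePerp (tracePerp U) = U :=
  LinearMap.BilinForm.orthogonal_orthogonal (traceForm_nondegenerate K F)
    (Algebra.traceForm_isSymm K).isRefl U

end Dual

/-! ### Orbits of subspaces: their number and the degree bound -/

section Orbits

variable {K F : Type*} [Field K] [Field F] [Algebra K F]

variable (K F) in
/-- The orbits of subspaces under multiplication by units. -/
abbrev SubspaceOrbit : Type _ := MulAction.orbitRel.Quotient Fˣ (Submodule K F)

/-- The orbit of a subspace. -/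
def orbitOf (U : Submodule K F) : SubspaceOrbit K F := Quotient.mk _ U

theorem orbitOf_eq {U V : Submodule K F} : orbitOf U = orbitOf V ↔ ∃ g : Fˣ, g • V = U :=
  Quotient.eq.trans (MulAction.orbitRel_apply.trans Iff.rfl)

theorem orbitOf_smul (g : Fˣ) (U : Submodule K F) : orbitOf (g • U) = orbitOf U :=
  orbitOf_eq.2 ⟨g, rfl⟩

theorem orbitOf_surjective : Function.Surjective (orbitOf : Submodule K F → SubspaceOrbit K F) :=
  Quotient.mk_surjective

namespace SubspaceOrbit

/-- The dimension of the members of an orbit. -/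
noncomputable def dim : SubspaceOrbit K F → ℕ :=
  Quotient.lift (fun U : Submodule K F => Module.finrank K U) fun U V h => by
    obtain ⟨g, rfl⟩ := MulAction.orbitRel_apply.1 h
    exact finrank_units_smul g V

@[simp] theorem dim_orbitOf (U : Submodule K F) : (orbitOf U).dim = Module.finrank K U := rfl

/-- The dual of an orbit. -/
noncomputable def perp : SubspaceOrbit K F → SubspaceOrbit K F :=
  Quotient.lift (fun U : Submodule K F => orbitOf (tracePerp U)) fun U V h => by
    obtain ⟨g, rfl⟩ := MulAction.orbitRel_apply.1 h
    change orbitOf (tracePerp (g • V)) = _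
    rw [tracePerp_smul, orbitOf_smul]

@[simp] theorem perp_orbitOf (U : Submodule K F) : (orbitOf U).perp = orbitOf (tracePerp U) := rfl

variable [FiniteDimensional K F]

open Classical in
/-- A generator of a subspace that is spanned by a unit (with a junk value otherwise). -/
noncomputable def unitGen (A : Submodule K F) : Fˣ :=
  if h : ∃ a : Fˣ, (a : F) ∈ A then h.choose else 1

theorem span_unitGen {A : Submodule K F} (hA : Module.finrank K A = 1) :
    A = Submodule.span K {(unitGen A : F)} := by
  have hex : ∃ a : Fˣ, (a : F) ∈ A := by
    have : A ≠ ⊥ := by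
      rintro rfl
      simp at hA
    obtain ⟨a, ha, h0⟩ := (Submodule.ne_bot_iff A).1 this
    exact ⟨Units.mk0 a h0, ha⟩
  have hmem : (unitGen A : F) ∈ A := by
    rw [unitGen, dif_pos hex]
    exact hex.choose_spec
  refine (Submodule.eq_of_le_of_finrank_eq ?_ ?_).symm
  · rwa [Submodule.span_singleton_le_iff_mem]
  · rw [finrank_span_singleton (Units.ne_zero _), hA]

theorem exists_unitGen_span {c : F} (hc : c ≠ 0) :
    ∃ s : K, s ≠ 0 ∧ (unitGen (Submodule.span K {c}) : F) = s • c := by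
  have h0 : Module.finrank K (Submodule.span K {c}) = 1 := finrank_span_singleton hc
  have h1 := span_unitGen h0
  have h2 : (unitGen (Submodule.span K {c}) : F) ∈ Submodule.span K {c} := by
    exact h1.ge (Submodule.mem_span_singleton_self _)
  obtain ⟨s, hs⟩ := Submodule.mem_span_singleton.1 h2
  refine ⟨s, ?_, hs.symm⟩
  rintro rfl
  rw [zero_smul] at hs
  exact (Units.ne_zero _) hs.symm

/-- A non-scalar `g` moves `L`, so `L ⊔ g • L` is strictly larger than `L` and fills `R` by
dimension. -/
theorem sup_smul_eq (hF : (Module.finrank K F).Prime) {L R : Submodule K F} {g : Fˣ}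
    (hbot : L ≠ ⊥) (htop : L ≠ ⊤) (hg : g ∉ scalarUnits K F)
    (hR : Module.finrank K R = Module.finrank K L + 1) (h1 : L ≤ R) (h2 : g • L ≤ R) :
    L ⊔ g • L = R := by
  refine Submodule.eq_of_le_of_finrank_le (sup_le h1 h2) ?_
  rw [hR]
  by_contra hlt
  have h3 : L = L ⊔ g • L := Submodule.eq_of_le_of_finrank_le le_sup_left (by omega)
  have h4 : g • L = L :=
    Submodule.eq_of_le_of_finrank_eq (sup_eq_left.1 h3.symm) (finrank_units_smul g L)
  exact hg (mem_scalarUnits_of_smul_eq hF hbot htop h4)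

/-- By dimension `L` meets `g • L` in some `a = g * b` with `a, b` in `L`. Thus `g` is `a / b`, and
up to scalars it depends only on the points spanned by `a` and `b`. -/
theorem exists_unitGen_quotient {L : Submodule K F} (hL : Module.finrank K L = 2) {g : Fˣ}
    (hg : g ∉ scalarUnits K F) (hsup : Module.finrank K (L ⊔ g • L : Submodule K F) = 3) :
    ∃ A B : Submodule K F, (Module.finrank K A = 1 ∧ A ≤ L) ∧ (Module.finrank K B = 1 ∧ B ≤ L) ∧
      A ≠ B ∧ (unitGen A * (unitGen B)⁻¹) • L = g • L ∧
        (unitGen A * (unitGen B)⁻¹)⁻¹ • L = g⁻¹ • L := by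
  have hinf : (L ⊓ g • L : Submodule K F) ≠ ⊥ := by
    intro h
    have := Submodule.finrank_sup_add_finrank_inf_eq L (g • L)
    rw [h, hsup, finrank_bot, finrank_units_smul, hL] at this
    omega
  obtain ⟨a, ⟨haL, ⟨b, hbL, hab⟩⟩, ha0⟩ := (Submodule.ne_bot_iff _).1 hinf
  have hab : (g : F) * b = a := hab
  have hb0 : b ≠ 0 := by
    rintro rfl
    exact ha0 (by rw [← hab, mul_zero])
  obtain ⟨s, hs0, hs⟩ := exists_unitGen_span (K := K) ha0
  obtain ⟨t, ht0, ht⟩ := exists_unitGen_span (K := K) hb0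
  have fA : Module.finrank K (Submodule.span K {a}) = 1 := finrank_span_singleton ha0
  have fB : Module.finrank K (Submodule.span K {b}) = 1 := finrank_span_singleton hb0
  have hne : Submodule.span K {a} ≠ Submodule.span K {b} := by
    intro hAB
    have : a ∈ Submodule.span K {b} := hAB ▸ Submodule.mem_span_singleton_self a
    obtain ⟨k, hk⟩ := Submodule.mem_span_singleton.1 this
    refine hg (mem_scalarUnits.2 ⟨k, ?_⟩)
    rw [Algebra.smul_def, ← hab] at hk
    exact mul_right_cancel₀ hb0 hk
  refine ⟨Submodule.span K {a}, Submodule.span K {b},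
    ⟨fA, (Submodule.span_singleton_le_iff_mem a L).2 haL⟩,
    ⟨fB, (Submodule.span_singleton_le_iff_mem b L).2 hbL⟩, hne, ?_⟩
  generalize unitGen (Submodule.span K {a}) = u at hs ⊢
  generalize unitGen (Submodule.span K {b}) = v at ht ⊢
  have hsc : (u * v⁻¹) * g⁻¹ ∈ scalarUnits K F := by
    refine mem_scalarUnits.2 ⟨s / t, ?_⟩
    have ht0' : algebraMap K F t ≠ 0 := by simpa using ht0
    rw [Units.val_mul, Units.val_mul, Units.val_inv_eq_inv_val, Units.val_inv_eq_inv_val, hs, ht,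
      ← hab, map_div₀, Algebra.smul_def, Algebra.smul_def]
    field_simp
  have hsm : (u * v⁻¹) • L = g • L := by
    have := units_smul_of_mem_scalarUnits hsc (g • L)
    rwa [mul_smul _ g⁻¹, inv_smul_smul] at this
  refine ⟨hsm, ?_⟩
  rw [inv_smul_eq_iff, smul_comm, hsm, inv_smul_smul]

variable [Finite K]

theorem perp_perp (ω : SubspaceOrbit K F) : ω.perp.perp = ω := by
  obtain ⟨U, rfl⟩ := orbitOf_surjective ω
  rw [perp_orbitOf, perp_orbitOf, tracePerp_tracePerp]

theorem perp_injective : Function.Injective (perp : SubspaceOrbit K F → SubspaceOrbit K F) :=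
  Function.LeftInverse.injective perp_perp

theorem dim_perp (ω : SubspaceOrbit K F) : ω.perp.dim = Module.finrank K F - ω.dim := by
  obtain ⟨U, rfl⟩ := orbitOf_surjective ω
  exact finrank_tracePerp U

/-- Every orbit of proper nonzero subspaces has the same size. -/
theorem ncard_finrank_eq (hF : (Module.finrank K F).Prime) {d : ℕ} (h0 : d ≠ 0)
    (hd : d ≠ Module.finrank K F) :
    {U : Submodule K F | Module.finrank K U = d}.ncard =
      {ω : SubspaceOrbit K F | ω.dim = d}.ncard * (scalarUnits K F).index := by
  have : Finite F := Module.finite_of_finite K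
  obtain ⟨x, hx⟩ := IsCyclic.exists_generator (α := Fˣ)
  obtain ⟨N, hN⟩ : ∃ N, (scalarUnits K F).index = N := ⟨_, rfl⟩
  have : NeZero N := ⟨hN ▸ Subgroup.index_ne_zero_of_finite⟩
  have hout : ∀ ω : SubspaceOrbit K F, ∃ U, orbitOf U = ω := orbitOf_surjective
  choose out hout using hout
  have hproper : ∀ U : Submodule K F, Module.finrank K U = d → U ≠ ⊥ ∧ U ≠ ⊤ := by
    rintro U hU
    constructor
    · rintro rfl
      exact h0 (by rw [← hU, finrank_bot])
    · rintro rfl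
      exact hd (by rw [← hU, finrank_top])
  rw [hN, ← Nat.card_zmod N, ← Nat.card_coe_set_eq, ← Nat.card_coe_set_eq, ← Nat.card_prod]
  have hd' : ∀ ω : SubspaceOrbit K F, ω.dim = d → Module.finrank K (out ω) = d := by
    intro ω hω
    rw [← dim_orbitOf, hout, hω]
  -- A subspace is coded by its orbit and the exponent that carries the chosen representative to it.
  refine Nat.card_congr (Equiv.ofBijective (fun ω => ⟨singerShift x ω.2 (out ω.1.1),
    (finrank_singerShift _ _).trans (hd' _ ω.1.2)⟩) ⟨?_, ?_⟩).symm
  · rintro ⟨⟨ω, hω⟩, i⟩ ⟨⟨ω', hω'⟩, i'⟩ h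
    have h' : singerShift x i (out ω) = singerShift x i' (out ω') := congrArg Subtype.val h
    have e : ω = ω' := by
      have := congrArg orbitOf h'
      rwa [singerShift, singerShift, orbitOf_smul, orbitOf_smul, hout, hout] at this
    subst e
    obtain ⟨p1, p2⟩ := hproper _ (hd' ω hω)
    rw [singerShift_injective hF hx hN p1 p2 h']
  · rintro ⟨U, hU⟩
    obtain ⟨g, hg⟩ := orbitOf_eq.1 (hout (orbitOf U)).symm
    obtain ⟨i, hi⟩ := exists_singerShift_eq hx hN g (out (orbitOf U))
    exact ⟨⟨⟨orbitOf U, hU⟩, i⟩, Subtype.ext (hi.trans hg)⟩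

/-- There are `1 + q + q²` 3-spaces through `L`, and at most `(q + 1) q` ordered pairs of distinct
ones share an orbit. The bound is `2 (1 + q + q²) - (q² + q)`. -/
theorem two_mul_ncard_orbits_ge (hF : Module.finrank K F = 5) {L : Submodule K F}
    (hL : Module.finrank K L = 2) :
    (Nat.card K) ^ 2 + Nat.card K + 2 ≤
      2 * (orbitOf '' {P : Submodule K F | Module.finrank K P = 3 ∧ L ≤ P}).ncard := by
  classical
  have hp : (Module.finrank K F).Prime := by rw [hF]; norm_num
  have : Finite F := Module.finite_of_finite K
  have := Fintype.ofFinite (Submodule K F)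
  obtain ⟨q, hq⟩ : ∃ q, Nat.card K = q := ⟨_, rfl⟩
  let S := Finset.univ.filter fun P : Submodule K F => Module.finrank K P = 3 ∧ L ≤ P
  let Q := Finset.univ.filter fun A : Submodule K F => Module.finrank K A = 1 ∧ A ≤ L
  have hS : S.card = 1 + q + q ^ 2 := by
    have := ncard_finrank_eq_add_one_ge (m := 3) hL (by rw [hF])
    rw [Set.ncard_eq_toFinset_card', Set.toFinset_ofPred] at this
    rw [this]
    simp [qNumber, Finset.sum_range_succ, hq]
  have hQ : Q.card = 1 + q := by
    have := ncard_finrank_eq_one_le hL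
    rw [Set.ncard_eq_toFinset_card', Set.toFinset_ofPred] at this
    rw [this]
    simp [qNumber, Finset.sum_range_succ, hq]
  have hpairs : (S.offDiag.filter fun p => orbitOf p.1 = orbitOf p.2).card ≤ Q.offDiag.card := by
    -- If `g • P = P'` for distinct `P, P'` through `L`, then `P' = L ⊔ g • L` and `P = L ⊔ g⁻¹ •
    -- L`, with `g` a quotient of generators of two points of `L`. So `f` covers all collisions.
    let f : Submodule K F × Submodule K F → Submodule K F × Submodule K F := fun p =>
      (L ⊔ (unitGen p.1 * (unitGen p.2)⁻¹)⁻¹ • L, L ⊔ (unitGen p.1 * (unitGen p.2)⁻¹) • L)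
    refine Finset.card_le_card_of_surjOn f ?_
    rintro ⟨P, P'⟩ hPP
    simp only [Finset.coe_filter, Finset.mem_offDiag, S, Finset.mem_filter, Finset.mem_univ,
      true_and, Set.mem_ofPred_eq] at hPP
    obtain ⟨⟨⟨hP, hLP⟩, ⟨hP', hLP'⟩, hne⟩, horb⟩ := hPP
    obtain ⟨g, hg⟩ := orbitOf_eq.1 horb.symm
    have hgs : g ∉ scalarUnits K F := fun h => hne (by
      rw [← hg, units_smul_of_mem_scalarUnits h])
    have hLbot : L ≠ ⊥ := by
      rintro rfl
      simp at hL
    have hLtop : L ≠ ⊤ := by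
      rintro rfl
      rw [finrank_top, hF] at hL
      omega
    have e1 : L ⊔ g • L = P' := sup_smul_eq hp hLbot hLtop hgs (by rw [hP', hL]) hLP'
      (hg ▸ units_smul_le_smul g hLP)
    have e2 : L ⊔ g⁻¹ • L = P := sup_smul_eq hp hLbot hLtop (fun h => hgs (by simpa using inv_mem h))
      (by rw [hP, hL]) hLP (by
        have := units_smul_le_smul g⁻¹ hLP'
        rwa [← hg, inv_smul_smul] at this)
    obtain ⟨A, B, hA, hB, hAB, h1, h2⟩ := exists_unitGen_quotient hL hgs (by rw [e1, hP'])
    refine ⟨(A, B), ?_, ?_⟩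
    · simp only [Q, Finset.mem_coe, Finset.mem_offDiag, Finset.mem_filter, Finset.mem_univ,
        true_and]
      exact ⟨hA, hB, hAB⟩
    · simp only [f]
      rw [h1, h2, e1, e2]
  have hmain := Finset.two_mul_card_le_of_pairs (orbitOf : Submodule K F → SubspaceOrbit K F) S
  have himg : (orbitOf '' {P : Submodule K F | Module.finrank K P = 3 ∧ L ≤ P}).ncard =
      (S.image orbitOf).card := by
    rw [← Set.ncard_coe_finset]
    congr 1
    ext ω
    simp [S]
  rw [himg, hq]
  rw [Finset.offDiag_card, hQ] at hpairs
  have h2 : (1 + q) * (1 + q) - (1 + q) = q ^ 2 + q := by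
    rw [show (1 + q) * (1 + q) = (q ^ 2 + q) + (1 + q) by ring, Nat.add_sub_cancel]
  rw [hS] at hmain
  omega

theorem two_mul_ncard_orbits_le (hF : Module.finrank K F = 5) {P : Submodule K F}
    (hP : Module.finrank K P = 3) :
    (Nat.card K) ^ 2 + Nat.card K + 2 ≤
      2 * (orbitOf '' {L : Submodule K F | Module.finrank K L = 2 ∧ L ≤ P}).ncard := by
  have h := two_mul_ncard_orbits_ge hF (L := tracePerp P) (by rw [finrank_tracePerp, hF, hP])
  have e : orbitOf '' {L : Submodule K F | Module.finrank K L = 2 ∧ L ≤ P} =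
      perp '' (orbitOf '' {R : Submodule K F | Module.finrank K R = 3 ∧ tracePerp P ≤ R}) := by
    ext ω
    constructor
    · rintro ⟨L, ⟨h1, h2⟩, rfl⟩
      refine ⟨_, ⟨tracePerp L, ⟨by rw [finrank_tracePerp, hF, h1], tracePerp_anti h2⟩, rfl⟩, ?_⟩
      rw [perp_orbitOf, tracePerp_tracePerp]
    · rintro ⟨_, ⟨R, ⟨h1, h2⟩, rfl⟩, rfl⟩
      refine ⟨tracePerp R, ⟨by rw [finrank_tracePerp, hF, h1], ?_⟩, rfl⟩
      have := tracePerp_anti h2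
      rwa [tracePerp_tracePerp] at this
  rwa [e, Set.ncard_image_of_injective _ perp_injective]

/-- There are `[5]_q [4]_q / [2]_q` planes, `[4]_q = (q² + 1) [2]_q`, and each orbit has `[5]_q`
members. -/
theorem ncard_dim_eq_two (hF : Module.finrank K F = 5) :
    {ω : SubspaceOrbit K F | ω.dim = 2}.ncard = (Nat.card K) ^ 2 + 1 := by
  have h1 := ncard_finrank_eq_two (K := K) (W := F) (m := 4) hF
  rw [ncard_finrank_eq (by rw [hF]; norm_num) (by norm_num) (by rw [hF]; norm_num),
    index_scalarUnits K F hF] at h1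
  set n := {ω : SubspaceOrbit K F | ω.dim = 2}.ncard
  have h5 : 0 < qNumber (Nat.card K) 5 := by
    simp [qNumber, Finset.sum_range_succ]
  have h2 : 0 < qNumber (Nat.card K) 2 := by
    simp [qNumber, Finset.sum_range_succ]
  have h4 : qNumber (Nat.card K) 4 = ((Nat.card K) ^ 2 + 1) * qNumber (Nat.card K) 2 := by
    simp [qNumber, Finset.sum_range_succ]
    ring
  refine Nat.eq_of_mul_eq_mul_right (Nat.mul_pos h5 h2) ?_
  rw [← mul_assoc, h1, h4]
  ring

theorem ncard_dim_eq_three (hF : Module.finrank K F = 5) :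
    {ω : SubspaceOrbit K F | ω.dim = 3}.ncard = (Nat.card K) ^ 2 + 1 := by
  rw [← ncard_dim_eq_two hF, ← Set.ncard_image_of_injective {ω | ω.dim = 2} perp_injective]
  congr 1
  ext ω
  constructor
  · intro h
    exact ⟨ω.perp, by rw [Set.mem_ofPred_eq, dim_perp, hF, h], perp_perp ω⟩
  · rintro ⟨ω, h, rfl⟩
    rw [Set.mem_ofPred_eq, dim_perp, hF, h]

end SubspaceOrbit

end Orbits

/-! ### The graph of orbits and its Hamiltonian path -/

namespace SubspaceOrbit

variable {K F : Type*} [Field K] [Field F] [Algebra K F]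

/-- Two orbits are linked when they have adjacent representatives. -/
def Linked (ω ω' : SubspaceOrbit K F) : Prop :=
  ∃ U V, orbitOf U = ω ∧ orbitOf V = ω' ∧ (projectiveSpaceGraph K F).Adj U V

theorem Linked.symm {ω ω' : SubspaceOrbit K F} (h : Linked ω ω') : Linked ω' ω := by
  obtain ⟨U, V, h1, h2, h3⟩ := h
  exact ⟨V, U, h2, h1, h3.symm⟩

theorem finrank_ne_of_adj {U V : Submodule K F} (h : (projectiveSpaceGraph K F).Adj U V) :
    Module.finrank K U ≠ Module.finrank K V := by
  intro e
  have h' : (Module.finrank K U : ℤ) + Module.finrank K V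
      - 2 * Module.finrank K (U ⊓ V : Submodule K F) = 1 := h
  omega

theorem Linked.dim_ne {ω ω' : SubspaceOrbit K F} (h : Linked ω ω') : ω.dim ≠ ω'.dim := by
  obtain ⟨U, V, rfl, rfl, h3⟩ := h
  exact finrank_ne_of_adj h3

theorem Linked.exists_adj {U : Submodule K F} {ω : SubspaceOrbit K F} (h : Linked (orbitOf U) ω) :
    ∃ V, orbitOf V = ω ∧ (projectiveSpaceGraph K F).Adj U V := by
  obtain ⟨U', V, h1, rfl, h3⟩ := h
  obtain ⟨g, rfl⟩ := orbitOf_eq.1 h1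
  refine ⟨g⁻¹ • V, orbitOf_smul _ _, ?_⟩
  have := projectiveSpaceGraph_adj_smul g⁻¹ h3
  rwa [inv_smul_smul] at this

/-- A chain of linked orbits lifts to a chain of adjacent subspaces with given start. -/
theorem exists_lift_of_isChain (l : List (SubspaceOrbit K F)) (U : Submodule K F)
    (h : (orbitOf U :: l).IsChain Linked) :
    ∃ L : List (Submodule K F), L.map orbitOf = l ∧
      (U :: L).IsChain (projectiveSpaceGraph K F).Adj := by
  induction l generalizing U with
  | nil => exact ⟨[], rfl, List.isChain_singleton _⟩
  | cons ω l ih =>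
    rw [List.isChain_cons_cons] at h
    obtain ⟨V, rfl, hV⟩ := h.1.exists_adj
    obtain ⟨L, hL, hc⟩ := ih V h.2
    exact ⟨V :: L, by rw [List.map_cons, hL], List.isChain_cons_cons.2 ⟨hV, hc⟩⟩

variable [Finite K] [FiniteDimensional K F]

/-- All orbits of planes and of three-spaces but one of each kind lie on a path. -/
theorem exists_path (hF : Module.finrank K F = 5) {ω₂ ω₃ : SubspaceOrbit K F}
    (h₂ : ω₂.dim = 2) (h₃ : ω₃.dim = 3) :
    ∃ l : List (SubspaceOrbit K F), l.Nodup ∧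
      (∀ ω, ω ∈ l ↔ (ω.dim = 2 ∨ ω.dim = 3) ∧ ω ≠ ω₂ ∧ ω ≠ ω₃) ∧ l.IsChain Linked ∧
      (∀ ω ∈ l.head?, ω.dim = 3) ∧ (∀ ω ∈ l.getLast?, ω.dim = 2) ∧
      l.length = 2 * (Nat.card K) ^ 2 := by
  classical
  have : Finite F := Module.finite_of_finite K
  have : Finite (SubspaceOrbit K F) := Quotient.finite _
  obtain ⟨q, hq⟩ : ∃ q, Nat.card K = q := ⟨_, rfl⟩
  have hq1 : 1 < q := hq ▸ Finite.one_lt_card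
  let V := {ω : SubspaceOrbit K F // (ω.dim = 2 ∨ ω.dim = 3) ∧ ω ≠ ω₂ ∧ ω ≠ ω₃}
  have := Fintype.ofFinite V
  let G : SimpleGraph V :=
    { Adj := fun u v => Linked u.1 v.1
      symm := ⟨fun u v h => Linked.symm h⟩
      loopless := ⟨fun u h => Linked.dim_ne h rfl⟩ }
  let col : V → Bool := fun v => decide (v.1.dim = 2)
  have hcol : ∀ u v, G.Adj u v → col u ≠ col v := by
    intro u v h
    have h1 := Linked.dim_ne h
    have h2 := u.2.1
    have h3 := v.2.1
    intro e
    rw [decide_eq_decide] at e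
    omega
  have c2 : (Finset.univ.filter fun v => col v = true).card = q ^ 2 := by
    rw [← Set.ncard_coe_finset, ← Set.ncard_image_of_injective _ Subtype.val_injective]
    have : (Subtype.val '' ((Finset.univ.filter fun v => col v = true : Finset V) : Set V)) =
        {ω : SubspaceOrbit K F | ω.dim = 2} \ {ω₂} := by
      ext ω
      constructor
      · rintro ⟨v, hv, rfl⟩
        exact ⟨of_decide_eq_true (Finset.mem_filter.1 hv).2, v.2.2.1⟩
      · rintro ⟨h1, h2⟩
        refine ⟨⟨ω, Or.inl h1, h2, ?_⟩,
          Finset.mem_filter.2 ⟨Finset.mem_univ _, decide_eq_true h1⟩, rfl⟩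
        rintro rfl
        rw [Set.mem_ofPred_eq] at h1
        omega
    rw [this, Set.ncard_sdiff_singleton_of_mem (a := ω₂) h₂, ncard_dim_eq_two hF, hq, Nat.add_sub_cancel]
  have c3 : (Finset.univ.filter fun v => col v = false).card = q ^ 2 := by
    rw [← Set.ncard_coe_finset, ← Set.ncard_image_of_injective _ Subtype.val_injective]
    have : (Subtype.val '' ((Finset.univ.filter fun v => col v = false : Finset V) : Set V)) =
        {ω : SubspaceOrbit K F | ω.dim = 3} \ {ω₃} := by
      ext ω
      constructor
      · rintro ⟨v, hv, rfl⟩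
        exact ⟨v.2.1.resolve_left (of_decide_eq_false (Finset.mem_filter.1 hv).2), v.2.2.2⟩
      · rintro ⟨h1, h2⟩
        rw [Set.mem_ofPred_eq] at h1
        refine ⟨⟨ω, Or.inr h1, ?_, h2⟩, ?_, rfl⟩
        · rintro rfl
          omega
        · refine Finset.mem_filter.2 ⟨Finset.mem_univ _, decide_eq_false ?_⟩
          change ω.dim ≠ 2
          omega
    rw [this, Set.ncard_sdiff_singleton_of_mem (a := ω₃) h₃, ncard_dim_eq_three hF, hq, Nat.add_sub_cancel]
  have hcard : ∀ c, (Finset.univ.filter fun v => col v = c).card = q ^ 2 := by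
    rintro (_ | _)
    exacts [c3, c2]
  have hdeg : ∀ v, q ^ 2 < 2 * {w | G.Adj v w}.ncard := by
    intro v
    -- Omitting the standard orbit costs at most one neighbour, which leaves twice the degree at
    -- least `q² + q > q²`.
    have aux : ∀ (T : Set (SubspaceOrbit K F)) (ω₀ : SubspaceOrbit K F),
        q ^ 2 + q + 2 ≤ 2 * T.ncard →
        (∀ ω ∈ T, ω ≠ ω₀ → Linked v.1 ω ∧ (ω.dim = 2 ∨ ω.dim = 3) ∧ ω ≠ ω₂ ∧ ω ≠ ω₃) →
        q ^ 2 < 2 * {w | G.Adj v w}.ncard := by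
      intro T ω₀ hT hsub
      have h1 : T \ {ω₀} ⊆ Subtype.val '' {w | G.Adj v w} := by
        rintro ω ⟨hω, hne⟩
        obtain ⟨hl, hV⟩ := hsub ω hω hne
        exact ⟨⟨ω, hV⟩, hl, rfl⟩
      have h2 := Set.ncard_le_ncard h1
      rw [Set.ncard_image_of_injective _ Subtype.val_injective] at h2
      change _ ≤ {w : V | G.Adj v w}.ncard at h2
      have h3 := Set.pred_ncard_le_ncard_sdiff_singleton T ω₀
      omega
    obtain ⟨U, hU⟩ := orbitOf_surjective v.1
    rcases v.2.1 with h | h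
    · rw [← hU, dim_orbitOf] at h
      refine aux _ ω₃ (hq ▸ two_mul_ncard_orbits_ge hF h) ?_
      rintro _ ⟨P, ⟨hP, hUP⟩, rfl⟩ hne
      refine ⟨⟨U, P, hU, rfl, projectiveSpaceGraph_adj_of_le hUP (by omega)⟩, Or.inr hP, ?_, hne⟩
      rintro rfl
      rw [dim_orbitOf] at h₂
      omega
    · rw [← hU, dim_orbitOf] at h
      refine aux _ ω₂ (hq ▸ two_mul_ncard_orbits_le hF h) ?_
      rintro _ ⟨P, ⟨hP, hUP⟩, rfl⟩ hne
      refine ⟨⟨U, P, hU, rfl, (projectiveSpaceGraph_adj_of_le hUP (by omega)).symm⟩, Or.inl hP,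
        hne, ?_⟩
      rintro rfl
      rw [dim_orbitOf] at h₃
      omega
  obtain ⟨l, hnd, hmem, hch, hh, hlast⟩ :=
    -- The colour `false` stands for dimension 3, so the path starts with a 3-space and ends with a
    -- plane.
    SimpleGraph.exists_hamiltonian_path_of_bipartite hcol hcard hdeg false
  refine ⟨l.map Subtype.val, hnd.map Subtype.val_injective, fun ω => ?_, ?_, ?_, ?_, ?_⟩
  · rw [List.mem_map]
    constructor
    · rintro ⟨v, -, rfl⟩
      exact v.2
    · exact fun h => ⟨⟨ω, h⟩, hmem _, rfl⟩
  · rw [List.isChain_map]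
    exact hch
  · intro ω hω
    rw [List.head?_map, Option.mem_def, Option.map_eq_some_iff] at hω
    obtain ⟨v, hv, rfl⟩ := hω
    exact v.2.1.resolve_left (by simpa [col] using hh v hv)
  · intro ω hω
    rw [List.getLast?_map, Option.mem_def, Option.map_eq_some_iff] at hω
    obtain ⟨v, hv, rfl⟩ := hω
    simpa [col] using hlast v hv
  · rw [List.length_map, hq]
    have h1 : l.toFinset = Finset.univ := by
      ext v
      simp [hmem]
    rw [← List.toFinset_card_of_nodup hnd, h1, ← Finset.card_filter_add_card_filter_not
      (s := Finset.univ) (fun v => col v = true), c2]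
    have : (Finset.univ.filter fun v => ¬ col v = true).card = q ^ 2 := by
      rw [← c3]
      congr 1
      ext v
      simp
    rw [this]
    ring

end SubspaceOrbit

/-! ### The size of an optimal code -/

theorem isOptimalSize_five {q : ℕ} {P : ℕ}
    (hP : P = 2 + qNumber q 5 * (4 + 2 * q ^ 2)) : IsOptimalSize 5 q P := by
  have pos : ∀ k, qNumber q (k + 1) ≠ 0 := fun k => by
    rw [qNumber, Finset.sum_range_succ']
    simp
  have h1 : (qNumber q 1 : ℚ) = 1 := by simp [qNumber]
  have h4 : (qNumber q 4 : ℚ) = qNumber q 2 * (q ^ 2 + 1) := by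
    simp only [qNumber, Finset.sum_range_succ, Finset.sum_range_zero]
    push_cast
    ring
  have p2 : (qNumber q 2 : ℚ) ≠ 0 := by exact_mod_cast pos 1
  have p3 : (qNumber q 3 : ℚ) ≠ 0 := by exact_mod_cast pos 2
  have p4 : (q : ℚ) ^ 2 + 1 ≠ 0 := by positivity
  have p5 : (qNumber q 5 : ℚ) ≠ 0 := by exact_mod_cast pos 4
  have f0 : (qFactorial q 0 : ℚ) = 1 := by simp [qFactorial]
  have f1 : (qFactorial q 1 : ℚ) = 1 := by simp [qFactorial, h1]
  have f2 : (qFactorial q 2 : ℚ) = qNumber q 2 := by simp [qFactorial, Finset.prod_range_succ, h1]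
  have f3 : (qFactorial q 3 : ℚ) = qNumber q 2 * qNumber q 3 := by
    simp [qFactorial, Finset.prod_range_succ, h1]
  have f4 : (qFactorial q 4 : ℚ) = qNumber q 2 * qNumber q 3 * (qNumber q 2 * (q ^ 2 + 1)) := by
    simp [qFactorial, Finset.prod_range_succ, h1, h4]
  have f5 : (qFactorial q 5 : ℚ) =
      qNumber q 2 * qNumber q 3 * (qNumber q 2 * (q ^ 2 + 1)) * qNumber q 5 := by
    simp [qFactorial, Finset.prod_range_succ, h1, h4]
  rw [IsOptimalSize, hP]
  simp only [gaussianCoeff, Finset.sum_range_succ, Finset.sum_range_zero, Nat.reduceSub, f0, f1, f2,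
    f3, f4, f5]
  push_cast
  field_simp
  ring

theorem ZigzagVertex.natCard_eq {N k : ℕ} [NeZero N] :
    Nat.card (ZigzagVertex N k) = 2 + N * (4 + (k + 1)) := by
  let f : ZigzagVertex N k ≃
      (Bool ⊕ ((Bool × Bool) ⊕ Fin (k + 1)) × ZMod N) :=
    { toFun := fun
        | bot => Sum.inl false
        | top => Sum.inl true
        | p i => Sum.inr (Sum.inl (false, false), i)
        | l i => Sum.inr (Sum.inl (false, true), i)
        | e i => Sum.inr (Sum.inl (true, false), i)
        | s i => Sum.inr (Sum.inl (true, true), i)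
        | r j i => Sum.inr (Sum.inr j, i)
      invFun := fun
        | Sum.inl false => bot
        | Sum.inl true => top
        | Sum.inr (Sum.inl (false, false), i) => p i
        | Sum.inr (Sum.inl (false, true), i) => l i
        | Sum.inr (Sum.inl (true, false), i) => e i
        | Sum.inr (Sum.inl (true, true), i) => s i
        | Sum.inr (Sum.inr j, i) => r j i
      left_inv := by rintro (_ | _ | _ | _ | _ | _ | _) <;> rfl
      right_inv := by rintro ((_ | _) | ⟨⟨_ | _, _ | _⟩ | _, _⟩) <;> rfl }
  rw [Nat.card_congr f]
  simp
  ring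

/-! ### Realising the zigzag graph by subspaces -/

section Main

variable {K F : Type*} [Field K] [Field F] [Algebra K F]

theorem orbitOf_singerShift {N : ℕ} {x : Fˣ} (i : ZMod N) (U : Submodule K F) :
    orbitOf (singerShift x i U) = orbitOf U := orbitOf_smul _ _

variable [FiniteDimensional K F]

theorem exists_units_smul_eq_of_finrank_eq_one {A B : Submodule K F} (hA : Module.finrank K A = 1)
    (hB : Module.finrank K B = 1) : ∃ g : Fˣ, g • A = B := by
  have hA' := SubspaceOrbit.span_unitGen hA
  have hB' := SubspaceOrbit.span_unitGen hB
  generalize SubspaceOrbit.unitGen A = a at hA'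
  generalize SubspaceOrbit.unitGen B = b at hB'
  refine ⟨b * a⁻¹, (Submodule.eq_of_le_of_finrank_eq ?_ ?_).symm⟩
  · rw [hB', Submodule.span_singleton_le_iff_mem]
    refine ⟨a, hA'.ge (Submodule.mem_span_singleton_self _), ?_⟩
    change ((b * a⁻¹ : Fˣ) : F) * a = b
    simp
  · rw [finrank_units_smul, hA, hB]

variable [Finite K]

theorem exists_units_smul_eq_of_finrank_eq_four (hF : Module.finrank K F = 5) {A B : Submodule K F}
    (hA : Module.finrank K A = 4) (hB : Module.finrank K B = 4) : ∃ g : Fˣ, g • A = B := by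
  obtain ⟨g, hg⟩ := exists_units_smul_eq_of_finrank_eq_one (A := tracePerp A) (B := tracePerp B)
    (by rw [finrank_tracePerp, hF, hA]) (by rw [finrank_tracePerp, hF, hB])
  refine ⟨g⁻¹, ?_⟩
  have := congrArg tracePerp hg
  rwa [tracePerp_smul, tracePerp_tracePerp, tracePerp_tracePerp] at this

theorem exists_smul_le_of_finrank (hF : Module.finrank K F = 5) {R S : Submodule K F}
    (hR : Module.finrank K R = 3) (hS : Module.finrank K S = 4) : ∃ g : Fˣ, g • R ≤ S := by
  have hQ : Module.finrank K (F ⧸ R) = 2 := by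
    have := Submodule.finrank_quotient_add_finrank R
    omega
  have h := ncard_finrank_eq_add_one_ge (m := 2) hR hF
  have hne : {V : Submodule K F | Module.finrank K V = 3 + 1 ∧ R ≤ V}.Nonempty := by
    refine Set.nonempty_of_ncard_ne_zero ?_
    rw [h]
    simp [qNumber, Finset.sum_range_succ]
  obtain ⟨V, hV, hRV⟩ := hne
  obtain ⟨g, hg⟩ := exists_units_smul_eq_of_finrank_eq_four hF hV hS
  exact ⟨g, hg ▸ units_smul_le_smul g hRV⟩

/-- The subspace attached to a vertex of the zigzag graph. -/
noncomputable def zigzagSubspace {N k : ℕ} (x : Fˣ) (R : Fin (k + 1) → Submodule K F) :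
    ZigzagVertex N k → Submodule K F
  | .bot => ⊥
  | .top => ⊤
  | .p i => singerShift x i (powerSpan K (x : F) 1)
  | .l i => singerShift x i (powerSpan K (x : F) 2)
  | .e i => singerShift x i (powerSpan K (x : F) 3)
  | .s i => singerShift x i (powerSpan K (x : F) 4)
  | .r j i => singerShift x i (R j)

theorem zigzagSubspace_bijective (hF : Module.finrank K F = 5) {N k : ℕ} [NeZero N] {x : Fˣ}
    (hx : ∀ g : Fˣ, g ∈ Subgroup.zpowers x) (hN : (scalarUnits K F).index = N)
    (hpow : ∀ j ≤ 5, Module.finrank K (powerSpan K (x : F) j) = j)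
    {R : Fin (k + 1) → Submodule K F} (hR : ∀ i j, orbitOf (R i) = orbitOf (R j) → i = j)
    (hmem : ∀ ω : SubspaceOrbit K F, (∃ j, orbitOf (R j) = ω) ↔ (ω.dim = 2 ∨ ω.dim = 3) ∧
      ω ≠ orbitOf (powerSpan K (x : F) 2) ∧ ω ≠ orbitOf (powerSpan K (x : F) 3)) :
    Function.Bijective (zigzagSubspace (N := N) x R) := by
  have hp : (Module.finrank K F).Prime := by rw [hF]; norm_num
  have hRdim : ∀ j, (Module.finrank K (R j) = 2 ∨ Module.finrank K (R j) = 3) ∧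
      orbitOf (R j) ≠ orbitOf (powerSpan K (x : F) 2) ∧
      orbitOf (R j) ≠ orbitOf (powerSpan K (x : F) 3) := fun j => (hmem _).1 ⟨j, rfl⟩
  have inj : ∀ {U : Submodule K F} {i j : ZMod N}, 1 ≤ Module.finrank K U → Module.finrank K U ≤ 4 →
      singerShift x i U = singerShift x j U → i = j := by
    intro U i j h1 h2 h
    refine singerShift_injective hp hx hN ?_ ?_ h
    · rintro rfl
      rw [finrank_bot] at h1
      omega
    · rintro rfl
      rw [finrank_top, hF] at h2
      omega
  have q1 := hpow 1 (by norm_num)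
  have q2 := hpow 2 (by norm_num)
  have q3 := hpow 3 (by norm_num)
  have q4 := hpow 4 (by norm_num)
  let dim : ZigzagVertex N k → ℕ
    | .bot => 0
    | .top => 5
    | .p _ => 1
    | .l _ => 2
    | .e _ => 3
    | .s _ => 4
    | .r j _ => Module.finrank K (R j)
  have hdims : ∀ u, Module.finrank K (zigzagSubspace x R u) = dim u := by
    rintro (_ | _ | i | i | i | i | ⟨j, i⟩)
    · exact finrank_bot K F
    · exact (finrank_top K F).trans hF
    · exact (finrank_singerShift _ _).trans q1
    · exact (finrank_singerShift _ _).trans q2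
    · exact (finrank_singerShift _ _).trans q3
    · exact (finrank_singerShift _ _).trans q4
    · exact finrank_singerShift _ _
  constructor
  · intro u v huv
    have hdim : dim u = dim v := by rw [← hdims, ← hdims, huv]
    have horb := congrArg orbitOf huv
    -- Dimension and orbit separate the layers; inside a layer the exponent is determined because
    -- stabilisers are scalar.
    rcases u with _ | _ | i | i | i | i | ⟨j, i⟩ <;>
      rcases v with _ | _ | i' | i' | i' | i' | ⟨j', i'⟩ <;>
      simp only [zigzagSubspace, dim, orbitOf_singerShift] at hdim horb huv ⊢ <;>
      first
      | rfl
      | (exfalso; omega)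
      | (exfalso; have := hRdim j; omega)
      | (exfalso; have := hRdim j'; omega)
      | (exfalso; exact (hRdim j).2.1 horb)
      | (exfalso; exact (hRdim j).2.2 horb)
      | (exfalso; exact (hRdim j').2.1 horb.symm)
      | (exfalso; exact (hRdim j').2.2 horb.symm)
      | (congr 1; exact inj (by omega) (by omega) huv)
      | skip
    obtain rfl := hR _ _ horb
    have := hRdim j
    congr 1
    exact inj (by omega) (by omega) huv
  · intro U
    have hle : Module.finrank K U ≤ 5 := hF ▸ Submodule.finrank_le U
    have shift : ∀ V : Submodule K F, orbitOf U = orbitOf V → ∃ i : ZMod N, singerShift x i V = U := by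
      intro V h
      obtain ⟨g, rfl⟩ := orbitOf_eq.1 h
      exact exists_singerShift_eq hx hN g V
    have five : Module.finrank K U = 2 ∨ Module.finrank K U = 3 →
        ∃ v : ZigzagVertex N k, zigzagSubspace x R v = U := by
      intro h
      by_cases h2 : orbitOf U = orbitOf (powerSpan K (x : F) 2)
      · obtain ⟨i, hi⟩ := shift _ h2
        exact ⟨.l i, hi⟩
      by_cases h3 : orbitOf U = orbitOf (powerSpan K (x : F) 3)
      · obtain ⟨i, hi⟩ := shift _ h3
        exact ⟨.e i, hi⟩
      obtain ⟨j, hj⟩ := (hmem (orbitOf U)).2 ⟨h, h2, h3⟩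
      obtain ⟨i, hi⟩ := shift _ hj.symm
      exact ⟨.r j i, hi⟩
    rcases (show Module.finrank K U = 0 ∨ Module.finrank K U = 1 ∨
      (Module.finrank K U = 2 ∨ Module.finrank K U = 3) ∨ Module.finrank K U = 4 ∨
      Module.finrank K U = 5 by omega) with h | h | h | h | h
    · exact ⟨.bot, (Submodule.finrank_eq_zero.1 h).symm⟩
    · obtain ⟨g, hg⟩ := exists_units_smul_eq_of_finrank_eq_one q1 h
      obtain ⟨i, hi⟩ := shift (powerSpan K (x : F) 1) (orbitOf_eq.2 ⟨g, hg⟩)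
      exact ⟨.p i, hi⟩
    · exact five h
    · obtain ⟨g, hg⟩ := exists_units_smul_eq_of_finrank_eq_four hF q4 h
      obtain ⟨i, hi⟩ := shift (powerSpan K (x : F) 4) (orbitOf_eq.2 ⟨g, hg⟩)
      exact ⟨.s i, hi⟩
    · exact ⟨.top, (Submodule.eq_top_of_finrank_eq (by rw [h, hF])).symm⟩

theorem exists_powerSpan_generator (hF : Module.finrank K F = 5) :
    ∃ x : Fˣ, (∀ g : Fˣ, g ∈ Subgroup.zpowers x) ∧
      ∀ j ≤ 5, Module.finrank K (powerSpan K (x : F) j) = j := by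
  have : Finite F := Module.finite_of_finite K
  obtain ⟨x, hx⟩ := IsCyclic.exists_generator (α := Fˣ)
  refine ⟨x, hx, fun j hj => finrank_powerSpan (by rw [hF]; norm_num) ?_ (by rw [hF]; exact hj)⟩
  intro h
  have hxs : x ∈ scalarUnits K F := mem_scalarUnits.2 h
  have htop : scalarUnits K F = ⊤ := by
    rw [eq_top_iff]
    intro g _
    exact (Subgroup.zpowers_le.2 hxs) (hx g)
  have h1 := index_scalarUnits K F hF
  have hq : 0 < Nat.card K := Nat.card_pos
  -- If `x` were a scalar, all units would be, and the index `[5]_q` would equal 1.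
  rw [htop, Subgroup.index_top] at h1
  simp [qNumber, Finset.sum_range_succ] at h1
  omega

/-- Representatives of all orbits of planes and three-spaces outside the standard flag, forming a
path that starts below a given four-space and ends above a standard point. -/
theorem exists_representatives (hF : Module.finrank K F = 5) {N : ℕ} [NeZero N] {x : Fˣ}
    (hx : ∀ g : Fˣ, g ∈ Subgroup.zpowers x) (hN : (scalarUnits K F).index = N)
    (hpow : ∀ j ≤ 5, Module.finrank K (powerSpan K (x : F) j) = j) :
    ∃ (k : ℕ) (R : Fin (k + 1) → Submodule K F) (c : ZMod N), k + 1 = 2 * (Nat.card K) ^ 2 ∧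
      (∀ i j, orbitOf (R i) = orbitOf (R j) → i = j) ∧
      (∀ ω : SubspaceOrbit K F, (∃ j, orbitOf (R j) = ω) ↔ (ω.dim = 2 ∨ ω.dim = 3) ∧
        ω ≠ orbitOf (powerSpan K (x : F) 2) ∧ ω ≠ orbitOf (powerSpan K (x : F) 3)) ∧
      (projectiveSpaceGraph K F).Adj (powerSpan K (x : F) 4) (R 0) ∧
      (∀ (j : ℕ) (hj : j < k), (projectiveSpaceGraph K F).Adj (R ⟨j, by omega⟩)
        (R ⟨j + 1, by omega⟩)) ∧
      (projectiveSpaceGraph K F).Adj (R (Fin.last k)) (singerShift x c (powerSpan K (x : F) 1)) ∧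
      c ≠ 1 := by
  have : Finite F := Module.finite_of_finite K
  have q1 := hpow 1 (by norm_num)
  have q4 := hpow 4 (by norm_num)
  obtain ⟨l, hnd, hmem, hch, hh, hlast, hlen⟩ := SubspaceOrbit.exists_path hF
    (ω₂ := orbitOf (powerSpan K (x : F) 2)) (ω₃ := orbitOf (powerSpan K (x : F) 3))
    (hpow 2 (by norm_num)) (hpow 3 (by norm_num))
  have hq : 0 < Nat.card K := Nat.card_pos
  cases l with
  | nil =>
    simp at hlen
    omega
  | cons ω t =>
    obtain ⟨U, rfl⟩ := orbitOf_surjective ω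
    have hU : Module.finrank K U = 3 := hh _ rfl
    -- Replacing the starting representative by a translate puts it inside the standard hyperplane
    -- without changing any orbit.
    obtain ⟨g, hg⟩ := exists_smul_le_of_finrank hF hU q4
    rw [← orbitOf_smul g U] at hnd hmem hch hlast
    have hU' : Module.finrank K (g • U : Submodule K F) = 3 := by rw [finrank_units_smul, hU]
    generalize g • U = V at *
    obtain ⟨L, rfl, hL⟩ := SubspaceOrbit.exists_lift_of_isChain t V hch
    rw [← List.map_cons] at hnd hmem hlast
    have hk : L.length + 1 = 2 * (Nat.card K) ^ 2 := by simpa using hlen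
    have hlast' : Module.finrank K ((V :: L)[L.length]'(by simp)) = 2 := by
      refine hlast (orbitOf ((V :: L)[L.length]'(by simp))) ?_
      rw [List.getLast?_map, List.getLast?_eq_getElem?]
      simp
    have hpts := ncard_finrank_eq_one_le hlast'
    obtain ⟨A, ⟨hA, hAL⟩, B, ⟨hB, hBL⟩, hAB⟩ := (Set.one_lt_ncard (Set.toFinite _)).1
      (show 1 < {H : Submodule K F | Module.finrank K H = 1 ∧
        H ≤ (V :: L)[L.length]'(by simp)}.ncard by
        rw [hpts]
        simp [qNumber, Finset.sum_range_succ, hq])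
    obtain ⟨a, rfl⟩ := exists_units_smul_eq_of_finrank_eq_one q1 hA
    obtain ⟨b, rfl⟩ := exists_units_smul_eq_of_finrank_eq_one q1 hB
    obtain ⟨i, hi⟩ := exists_singerShift_eq hx hN a (powerSpan K (x : F) 1)
    obtain ⟨j, hj⟩ := exists_singerShift_eq hx hN b (powerSpan K (x : F) 1)
    -- The final plane contains at least two points; their exponents differ, so one of them is not
    -- 1.
    have hc : ∃ c : ZMod N, c ≠ 1 ∧
        singerShift x c (powerSpan K (x : F) 1) ≤ (V :: L)[L.length]'(by simp) := by
      by_cases h1 : i = 1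
      · refine ⟨j, fun h => hAB ?_, hj ▸ hBL⟩
        rw [← hi, ← hj, h, h1]
      · exact ⟨i, h1, hi ▸ hAL⟩
    obtain ⟨c, hc1, hc⟩ := hc
    refine ⟨L.length, fun j => (V :: L)[j.1]'(by have := j.2; simp; omega), c, hk, ?_, ?_, ?_, ?_, ?_, hc1⟩
    · intro i j hij
      refine Fin.ext ((List.Nodup.getElem_inj_iff hnd (hi := by have := i.2; simp; omega)
        (hj := by have := j.2; simp; omega)).1 ?_)
      rw [List.getElem_map, List.getElem_map]
      exact hij
    · intro ω
      rw [← hmem, List.mem_map]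
      constructor
      · rintro ⟨j, hj⟩
        exact ⟨_, List.getElem_mem _, hj⟩
      · rintro ⟨W, hW, h⟩
        obtain ⟨n, hn, rfl⟩ := List.mem_iff_getElem.1 hW
        exact ⟨⟨n, by simpa using hn⟩, h⟩
    · exact (projectiveSpaceGraph_adj_of_le hg (by rw [q4, hU'])).symm
    · intro j hj
      exact List.isChain_iff_getElem.1 hL j (by simpa using hj)
    · refine (projectiveSpaceGraph_adj_of_le hc ?_).symm
      rw [finrank_singerShift, q1]
      exact hlast'

end Main

theorem zigzagSubspace_isZigzag {K F : Type*} [Field K] [Field F] [Algebra K F]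
    (hF : Module.finrank K F = 5) {N k : ℕ} [NeZero N] {x : Fˣ}
    (hx : ∀ g : Fˣ, g ∈ Subgroup.zpowers x) (hN : (scalarUnits K F).index = N)
    (hpow : ∀ j ≤ 5, Module.finrank K (powerSpan K (x : F) j) = j)
    {R : Fin (k + 1) → Submodule K F} {c : ZMod N}
    (h0 : (projectiveSpaceGraph K F).Adj (powerSpan K (x : F) 4) (R 0))
    (hR : ∀ (j : ℕ) (hj : j < k), (projectiveSpaceGraph K F).Adj (R ⟨j, by omega⟩)
        (R ⟨j + 1, by omega⟩))
    (hc : (projectiveSpaceGraph K F).Adj (R (Fin.last k))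
      (singerShift x c (powerSpan K (x : F) 1))) :
    ZigzagVertex.IsZigzag c
      ((projectiveSpaceGraph K F).comap (zigzagSubspace (N := N) x R)) := by
  have step : ∀ j, j < 5 → (projectiveSpaceGraph K F).Adj (powerSpan K (x : F) j)
      (powerSpan K (x : F) (j + 1)) := fun j hj =>
    projectiveSpaceGraph_adj_of_le (powerSpan_le_succ _ _)
      (by rw [hpow j (by omega), hpow (j + 1) (by omega)])
  -- These are the zigzag edges: `x` times the span of `j` powers lies in the span of `j + 1`
  -- powers.
  have step' : ∀ j, j < 5 → ∀ i : ZMod N, (projectiveSpaceGraph K F).Adj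
      (singerShift x (i + 1) (powerSpan K (x : F) j))
      (singerShift x i (powerSpan K (x : F) (j + 1))) := by
    intro j hj i
    have h1 : singerShift x (1 : ZMod N) (powerSpan K (x : F) j) = x • powerSpan K (x : F) j := by
      have := singerShift_natCast hx hN 1 (powerSpan K (x : F) j)
      rwa [Nat.cast_one, pow_one] at this
    rw [singerShift_add hx hN, h1]
    exact singerShift_adj i (projectiveSpaceGraph_adj_of_le (smul_powerSpan_le_succ x j)
      (by rw [finrank_units_smul, hpow j (by omega), hpow (j + 1) (by omega)]))
  exact
    { bot_p := fun i => projectiveSpaceGraph_adj_of_le (U := ⊥) bot_le (by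
        rw [finrank_bot, zero_add]
        exact (finrank_singerShift _ _).trans (hpow 1 (by norm_num)))
      top_s := fun i => (projectiveSpaceGraph_adj_of_le (V := ⊤) le_top (by
        rw [finrank_top, hF]
        exact congrArg (· + 1) ((finrank_singerShift i _).trans (hpow 4 (by norm_num))).symm)).symm
      p_l := fun i => singerShift_adj i (step 1 (by norm_num))
      p_l' := fun i => step' 1 (by norm_num) i
      l_e := fun i => singerShift_adj i (step 2 (by norm_num))
      l_e' := fun i => step' 2 (by norm_num) i
      e_s := fun i => singerShift_adj i (step 3 (by norm_num))
      s_r := fun i => singerShift_adj i h0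
      r_r := fun j hj i => singerShift_adj i (hR j hj)
      r_p := fun i => by
        have := singerShift_adj (x := x) i hc
        rwa [← singerShift_add hx hN] at this }

theorem exists_cyclic_code_of_algebra {K F : Type*} [Field K] [Field F] [Algebra K F]
    [Finite K] [FiniteDimensional K F] (hF : Module.finrank K F = 5) :
    ∃ (P : ℕ) (C : Fin P → Submodule K F),
      IsSubspaceGrayCode C ∧ IsCyclicCode C ∧ IsOptimalSize 5 (Nat.card K) P := by
  obtain ⟨x, hx, hpow⟩ := exists_powerSpan_generator (K := K) (F := F) hF
  obtain ⟨N, hN⟩ : ∃ N, (scalarUnits K F).index = N := ⟨_, rfl⟩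
  have hNq : N = qNumber (Nat.card K) 5 := hN ▸ index_scalarUnits K F hF
  have hq : 1 < Nat.card K := Finite.one_lt_card
  have hN4 : 4 ≤ N := by
    rw [hNq]
    simp only [qNumber, Finset.sum_range_succ, Finset.sum_range_zero]
    nlinarith [Nat.zero_le (Nat.card K ^ 3), Nat.zero_le (Nat.card K ^ 4)]
  have : NeZero N := ⟨by omega⟩
  obtain ⟨k, R, c, hk, hRinj, hRmem, h0, hR, hc, hc1⟩ := exists_representatives hF hx hN hpow
  have hbij := zigzagSubspace_bijective hF hx hN hpow hRinj hRmem
  have : Finite F := Module.finite_of_finite K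
  have : Finite (ZigzagVertex N k) := Finite.of_injective _ hbij.1
  have : Nonempty (ZigzagVertex N k) := ⟨.bot⟩
  have hzig := zigzagSubspace_isZigzag hF hx hN hpow h0 hR hc
  obtain ⟨H, hHG, hH2, hconn⟩ := hzig.exists_hamiltonian hN4 hc1
  obtain ⟨P, hP, C, hC, hadj, hcyc⟩ := SimpleGraph.exists_cyclic_enumeration _ H hHG hH2 hconn
  refine ⟨P, fun i => zigzagSubspace x R (C i), ⟨hbij.1.comp hC.1, hadj⟩, ⟨hP, hcyc⟩, ?_⟩
  refine isOptimalSize_five ?_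
  have := Nat.card_congr (Equiv.ofBijective C hC)
  rw [Nat.card_fin, ZigzagVertex.natCard_eq, hk, hNq] at this
  exact this

theorem mainTheorem6 (q : ℕ) (hq : IsPrimePow q)
    (K : Type*) [Field K] (hK : Nat.card K = q)
    (W : Type*) [AddCommGroup W] [Module K W] (hW : Module.finrank K W = 5) :
    ∃ (P : ℕ) (C : Fin P → Submodule K W),
      IsSubspaceGrayCode C ∧ IsCyclicCode C ∧ IsOptimalSize 5 q P := by
  subst hK
  -- `Nat.card` is 0 on infinite types, so a positive cardinality forces finiteness.
  have : Finite K := Nat.finite_of_card_ne_zero hq.pos.ne'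
  obtain ⟨p, hp⟩ := CharP.exists K
  have : Fact p.Prime := ⟨CharP.char_is_prime K p⟩
  have hF : Module.finrank K (FiniteField.Extension K p 5) = 5 :=
    FiniteField.finrank_extension K p 5
  have : FiniteDimensional K W := FiniteDimensional.of_finrank_pos (by omega)
  -- Adjacency depends only on the linear structure, so the code is built in the field and
  -- transported along `e`.
  obtain ⟨e⟩ : Nonempty (FiniteField.Extension K p 5 ≃ₗ[K] W) :=
    FiniteDimensional.nonempty_linearEquiv_of_finrank_eq (hF.trans hW.symm)
  obtain ⟨P, C, ⟨hinj, hadj⟩, ⟨hP, hcyc⟩, hsize⟩ := exists_cyclic_code_of_algebra hF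
  exact ⟨P, fun i => (C i).map e.toLinearMap,
    ⟨(Submodule.map_injective_of_injective e.injective).comp hinj,
      fun i hi => projectiveSpaceGraph_adj_map e (hadj i hi)⟩,
    ⟨hP, projectiveSpaceGraph_adj_map e hcyc⟩, hsize⟩
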